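/- Let $\mathbb O$ be the octonions with basis $1,e_1,\dots,e_7$, where $e_i^2=-1$, $e_je_i=-e_ie_j$ for $i\neq j$, and $e_1e_2=-e_5$, $e_1e_3=-e_6$, $e_1e_4=-e_7$, $e_2e_3=-e_7$, $e_2e_4=e_6$, $e_3e_4=-e_5$, $e_5e_6=e_7$, the other products being determined by the rule that $e_ie_j=\pm e_k$ implies $e_je_k=\pm e_i$ with the same sign. Let $\mathbb O_{\mathbb C}=\mathbb O\otimes\mathbb C$ and $\mathbb C^7=\operatorname{Im}(\mathbb O)\otimes\mathbb C$. For $x,y\in\mathbb C^7$ let $x\cdot y\in\mathbb C^7$ be the octonionic-imaginary part of the product $xy$, and let $\langle x,y\rangle=\sum_i x_iy_i$. Let $\mathbb G_2\subset \mathrm{SO}(7,\mathbb C)$ be the automorphism group of $\mathbb O_{\mathbb C}$, acting on $\mathbb C^7$, with the antiholomorphic involution $\tau(A)=\overline A$, whose fixed point group is the compact group $\mathrm G_2$. Let $\mathcal L_-^\tau(\mathbb G_2,\mathbb C^7)$ be the group, under pointwise multiplication, of holomorphic maps $g:U\to\mathbb G_2$, with $U\subset\mathbb{CP}^1$ open and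 dense and with two maps identified if they agree on an open dense set, such that - (rational) $g$, as a map to $\operatorname{End}(\mathbb C^7)$, is meromorphic on $\mathbb{CP}^1$; - (negative) $g$ is holomorphic at $\infty$ and $g(\infty)=\mathrm{Id}$; - (real) $\tau(g(\bar\lambda))=g(\lambda)$. A complex coassociative plane is a two-dimensional complex subspace $\mathcal C\subset\mathbb C^7$ with $\langle x,y\rangle=0$ and $x\cdot y=0$ for all $x,y\in\mathcal C$. Put $\mathcal A=(\mathcal C\oplus\overline{\mathcal C})^\perp$. Then $\mathbb C^7=\mathcal C\oplus\mathcal A\oplus\overline{\mathcal C}$ is a hermitian orthogonal decomposition, with orthogonal projections $\pi_{\mathcal C},\pi_{\mathcal A},\pi_{\overline{\mathcal C}}$. For $\alpha\in\mathbb C\setminus\mathbb R$ let $$p_{\alpha,\mathcal C}(\lambda)=\frac{\lambda-\bar\alpha}{\lambda-\alpha}\,\pi_{\overline{\mathcal C}}+\pi_{\mathcal A}+\frac{\lambda-\alpha}{\lambda-\bar\alpha}\,\pi_{\mathcal C}.$$ **Theorem.** The simple elements $p_{\alpha,\mathcal C}$, where $\alpha\in\mathbb C\setminus\mathbb R$ and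 $\mathcal C\subset\mathbb C^7$ is a complex coassociative plane, belong to the group $\mathcal L_-^\tau(\mathbb G_2,\mathbb C^7)$ and generate it. -/

import Mathlib

open Filter
open scoped OnePoint Matrix

/-! ### The complexified octonions and the complex group `G₂` -/

/-- The octonionic-imaginary part `x · y` of the product of two imaginary octonions, extended
complex bilinearly to `ℂ⁷ = Im 𝕆 ⊗ ℂ`.  In the basis `e₁, …, e₇` (coordinates `0, …, 6`):
`e₁e₂ = -e₅`, `e₁e₃ = -e₆`, `e₁e₄ = -e₇`, `e₁e₅ = e₂`, `e₁e₆ = e₃`, `e₁e₇ = e₄`,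
`e₂e₃ = -e₇`, `e₂e₄ = e₆`, `e₂e₅ = -e₁`, `e₂e₆ = -e₄`, `e₂e₇ = e₃`,
`e₃e₄ = -e₅`, `e₃e₅ = e₄`, `e₃e₆ = -e₁`, `e₃e₇ = -e₂`,
`e₄e₅ = -e₃`, `e₄e₆ = e₂`, `e₄e₇ = -e₁`, `e₅e₆ = e₇`, `e₅e₇ = -e₆`, `e₆e₇ = e₅`,
and `eⱼeᵢ = -eᵢeⱼ` for `i ≠ j`. -/
def imMul (x y : Fin 7 → ℂ) : Fin 7 → ℂ :=
  ![(x 4 * y 1 - x 1 * y 4) + (x 5 * y 2 - x 2 * y 5) + (x 6 * y 3 - x 3 * y 6),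
    (x 0 * y 4 - x 4 * y 0) + (x 6 * y 2 - x 2 * y 6) + (x 3 * y 5 - x 5 * y 3),
    (x 0 * y 5 - x 5 * y 0) + (x 1 * y 6 - x 6 * y 1) + (x 4 * y 3 - x 3 * y 4),
    (x 0 * y 6 - x 6 * y 0) + (x 5 * y 1 - x 1 * y 5) + (x 2 * y 4 - x 4 * y 2),
    (x 1 * y 0 - x 0 * y 1) + (x 3 * y 2 - x 2 * y 3) + (x 5 * y 6 - x 6 * y 5),
    (x 2 * y 0 - x 0 * y 2) + (x 1 * y 3 - x 3 * y 1) + (x 6 * y 4 - x 4 * y 6),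
    (x 3 * y 0 - x 0 * y 3) + (x 2 * y 1 - x 1 * y 2) + (x 4 * y 5 - x 5 * y 4)]

/-- The product of `𝕆 ⊗ ℂ = ℂ · 1 ⊕ ℂ⁷`.  On basis vectors it is given by the table of `imMul`
together with `eᵢeᵢ = -1` and `1` being the unit. -/
def octMul (p q : ℂ × (Fin 7 → ℂ)) : ℂ × (Fin 7 → ℂ) :=
  (p.1 * q.1 - p.2 ⬝ᵥ q.2, p.1 • q.2 + q.1 • p.2 + imMul p.2 q.2)

/-- The linear map `id ⊕ A` of `𝕆 ⊗ ℂ = ℂ · 1 ⊕ ℂ⁷`. -/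
def octExtend (A : Matrix (Fin 7) (Fin 7) ℂ) (p : ℂ × (Fin 7 → ℂ)) : ℂ × (Fin 7 → ℂ) :=
  (p.1, A *ᵥ p.2)

/-- The complex group `G₂`, the automorphism group of `𝕆 ⊗ ℂ`, in its representation on
`ℂ⁷ = Im 𝕆 ⊗ ℂ`.  (An automorphism fixes `1`, and it preserves `ℂ⁷`, whose nonzero elements are
those `x ∉ ℂ · 1` with `x² ∈ ℂ · 1`; so it is of the form `id ⊕ A`.) -/
def complexG2 : Subgroup (GL (Fin 7) ℂ) where
  carrier := {A | ∀ p q, octExtend A (octMul p q) = octMul (octExtend A p) (octExtend A q)}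
  one_mem' := by
    intro p q
    simp [octExtend]
  mul_mem' := by
    intro A B hA hB p q
    have h : ∀ r, octExtend ((A * B : GL (Fin 7) ℂ) : Matrix (Fin 7) (Fin 7) ℂ) r
        = octExtend A (octExtend B r) := by
      intro r; simp [octExtend]
    simp only [Set.mem_ofPred_eq] at hA hB
    rw [h, h, h, hB, hA]
  inv_mem' := by
    intro A hA p q
    have h1 : ∀ r, octExtend A
        (octExtend ((A⁻¹ : GL (Fin 7) ℂ) : Matrix (Fin 7) (Fin 7) ℂ) r) = r := by
      intro r
      simp only [octExtend, Matrix.mulVec_mulVec, ← Units.val_mul, mul_inv_cancel, Units.val_one,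
        Matrix.one_mulVec]
    have h2 : ∀ r, octExtend ((A⁻¹ : GL (Fin 7) ℂ) : Matrix (Fin 7) (Fin 7) ℂ)
        (octExtend A r) = r := by
      intro r
      simp only [octExtend, Matrix.mulVec_mulVec, ← Units.val_mul, inv_mul_cancel, Units.val_one,
        Matrix.one_mulVec]
    simp only [Set.mem_ofPred_eq] at hA
    conv_lhs => rw [← h1 p, ← h1 q, ← hA, h2]

/-! ### Holomorphic and meromorphic maps on `ℂP¹ = OnePoint ℂ` -/

/-- The filter of all subsets of `X` that contain an open dense set. -/
def denseOpen (X : Type*) [TopologicalSpace X] : Filter X where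
  sets := {s | ∃ U : Set X, IsOpen U ∧ Dense U ∧ U ⊆ s}
  univ_sets := ⟨Set.univ, isOpen_univ, dense_univ, subset_rfl⟩
  sets_of_superset := by
    rintro s t ⟨U, hU, hd, hs⟩ hst
    exact ⟨U, hU, hd, hs.trans hst⟩
  inter_sets := by
    rintro s t ⟨U, hU, hUd, hs⟩ ⟨W, hW, hWd, ht⟩
    exact ⟨U ∩ W, hU.inter hW, hUd.inter_of_isOpen_left hWd hU, Set.inter_subset_inter hs ht⟩

open Classical in
/-- The inverse of the standard holomorphic chart of `ℂP¹` at a point: the inclusion of `ℂ` at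
finite points, and `w ↦ 1 / w` (with `0 ↦ ∞`) at `∞`. -/
noncomputable def cpCoord : OnePoint ℂ → ℂ → OnePoint ℂ
  | ∞ => fun w => if w = 0 then ∞ else ((w⁻¹ : ℂ) : OnePoint ℂ)
  | (_ : ℂ) => fun w => (w : OnePoint ℂ)

/-- The coordinate of a point of `ℂP¹` in the standard chart at that point. -/
def cpCenter : OnePoint ℂ → ℂ
  | ∞ => 0
  | (z : ℂ) => z

/-- A matrix-valued map on `ℂP¹` is holomorphic (in a neighbourhood of, and) at the point `p`. -/
def HolomorphicAtPt {n : ℕ} (M : OnePoint ℂ → Matrix (Fin n) (Fin n) ℂ) (p : OnePoint ℂ) : Prop :=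
  ∀ i j, AnalyticAt ℂ (fun w => M (cpCoord p w) i j) (cpCenter p)

/-- A matrix-valued map on `ℂP¹` is meromorphic at the point `p`. -/
def MeromorphicAtPt {n : ℕ} (M : OnePoint ℂ → Matrix (Fin n) (Fin n) ℂ) (p : OnePoint ℂ) : Prop :=
  ∀ i j, MeromorphicAt (fun w => M (cpCoord p w) i j) (cpCenter p)

/-! ### Loop groups -/

/-- Maps from open dense subsets of `ℂP¹` to `GL(n, ℂ)`, where maps that agree on an open dense set
are identified. -/
abbrev LoopGerm (n : ℕ) : Type := Germ (denseOpen (OnePoint ℂ)) (GL (Fin n) ℂ)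

theorem HolomorphicAtPt.mul {n : ℕ} {M N : OnePoint ℂ → Matrix (Fin n) (Fin n) ℂ} {p : OnePoint ℂ}
    (hM : HolomorphicAtPt M p) (hN : HolomorphicAtPt N p) :
    HolomorphicAtPt (fun q => M q * N q) p := by
  intro i j
  simp only [Matrix.mul_apply]
  exact Finset.analyticAt_fun_sum _ fun k _ => (hM i k).mul (hN k j)

theorem MeromorphicAtPt.mul {n : ℕ} {M N : OnePoint ℂ → Matrix (Fin n) (Fin n) ℂ} {p : OnePoint ℂ}
    (hM : MeromorphicAtPt M p) (hN : MeromorphicAtPt N p) :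
    MeromorphicAtPt (fun q => M q * N q) p := by
  intro i j
  simp only [Matrix.mul_apply]
  exact MeromorphicAt.fun_sum fun k _ => (hM i k).mul (hN k j)

theorem HolomorphicAtPt.one {n : ℕ} {p : OnePoint ℂ} :
    HolomorphicAtPt (fun _ => (1 : Matrix (Fin n) (Fin n) ℂ)) p :=
  fun _ _ => analyticAt_const

theorem HolomorphicAtPt.inv {n : ℕ} {f : OnePoint ℂ → GL (Fin n) ℂ} {p : OnePoint ℂ}
    (hf : HolomorphicAtPt (fun q => (f q : Matrix (Fin n) (Fin n) ℂ)) p) :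
    HolomorphicAtPt (fun q => (((f q)⁻¹ : GL (Fin n) ℂ) : Matrix (Fin n) (Fin n) ℂ)) p := by
  intro i j
  have hdet : ∀ N : ℂ → Matrix (Fin n) (Fin n) ℂ,
      (∀ i j, AnalyticAt ℂ (fun w => N w i j) (cpCenter p)) →
      AnalyticAt ℂ (fun w => (N w).det) (cpCenter p) := by
    intro N hN
    simp only [Matrix.det_apply']
    exact Finset.analyticAt_fun_sum _ fun σ _ => analyticAt_const.mul
      (Finset.analyticAt_fun_prod _ fun k _ => hN _ _)
  simp only [Matrix.coe_units_inv, Matrix.inv_def, Ring.inverse_eq_inv', Matrix.smul_apply,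
    smul_eq_mul, Matrix.adjugate_apply]
  refine ((hdet _ hf).inv ((f _).isUnit.map Matrix.detMonoidHom).ne_zero).mul (hdet _ ?_)
  intro a b
  by_cases h : a = j
  · subst h
    simpa using analyticAt_const
  · simpa [Matrix.updateRow_apply, h] using hf a b

theorem MeromorphicAtPt.inv {n : ℕ} {M : OnePoint ℂ → Matrix (Fin n) (Fin n) ℂ} {p : OnePoint ℂ}
    (hM : MeromorphicAtPt M p) : MeromorphicAtPt (fun q => (M q)⁻¹) p := by
  intro i j
  have hdet : ∀ N : ℂ → Matrix (Fin n) (Fin n) ℂ,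
      (∀ i j, MeromorphicAt (fun w => N w i j) (cpCenter p)) →
      MeromorphicAt (fun w => (N w).det) (cpCenter p) := by
    intro N hN
    simp only [Matrix.det_apply']
    exact MeromorphicAt.fun_sum fun σ _ => (MeromorphicAt.const _ _).mul
      (MeromorphicAt.fun_prod fun k _ => hN _ _)
  simp only [Matrix.inv_def, Ring.inverse_eq_inv', Matrix.smul_apply,
    smul_eq_mul, Matrix.adjugate_apply]
  refine (hdet _ hM).inv.mul (hdet _ ?_)
  intro a b
  by_cases h : a = j
  · subst h
    simp
  · simpa [Matrix.updateRow_apply, h] using hM a b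

/-- The holomorphic loop group of `G ⊆ GL(n, ℂ)`: holomorphic maps `U → G` with `U ⊆ ℂP¹` open and
dense. -/
def holomorphicLoops {n : ℕ} (G : Subgroup (GL (Fin n) ℂ)) : Subgroup (LoopGerm n) where
  carrier := {γ | ∃ f : OnePoint ℂ → GL (Fin n) ℂ, γ = ↑f ∧
    ∃ U : Set (OnePoint ℂ), IsOpen U ∧ Dense U ∧
      ∀ p ∈ U, f p ∈ G ∧ HolomorphicAtPt (fun q => (f q : Matrix (Fin n) (Fin n) ℂ)) p}
  one_mem' := ⟨1, rfl, Set.univ, isOpen_univ, dense_univ,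
    fun _ _ => ⟨G.one_mem, HolomorphicAtPt.one⟩⟩
  mul_mem' := by
    rintro _ _ ⟨f, rfl, U, hU, hUd, hf⟩ ⟨g, rfl, W, hW, hWd, hg⟩
    exact ⟨f * g, rfl, U ∩ W, hU.inter hW, hUd.inter_of_isOpen_left hWd hU, fun p hp =>
      ⟨G.mul_mem (hf p hp.1).1 (hg p hp.2).1, (hf p hp.1).2.mul (hg p hp.2).2⟩⟩
  inv_mem' := by
    rintro _ ⟨f, rfl, U, hU, hUd, hf⟩
    exact ⟨f⁻¹, rfl, U, hU, hUd, fun p hp => ⟨G.inv_mem (hf p hp).1, HolomorphicAtPt.inv (hf p hp).2⟩⟩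

/-- Loops that agree on an open dense set with a matrix-valued map that is meromorphic on all of
`ℂP¹`. -/
def rationalLoops (n : ℕ) : Subgroup (LoopGerm n) where
  carrier := {γ | ∃ M : OnePoint ℂ → Matrix (Fin n) (Fin n) ℂ,
    γ.map (fun A : GL (Fin n) ℂ => (A : Matrix (Fin n) (Fin n) ℂ)) = ↑M ∧
      ∀ p, MeromorphicAtPt M p}
  one_mem' := ⟨fun _ => 1, rfl, fun _ _ _ => MeromorphicAt.const _ _⟩
  mul_mem' := by
    intro γ δ
    induction γ using Germ.inductionOn with | _ f
    induction δ using Germ.inductionOn with | _ g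
    rintro ⟨M, hM, hM'⟩ ⟨N, hN, hN'⟩
    refine ⟨fun q => M q * N q, ?_, fun p => (hM' p).mul (hN' p)⟩
    rw [Germ.map_coe, Germ.coe_eq] at hM hN
    rw [← Germ.coe_mul, Germ.map_coe, Germ.coe_eq]
    filter_upwards [hM, hN] with q h1 h2
    simp only [Function.comp_apply] at h1 h2
    simp [h1, h2]
  inv_mem' := by
    intro γ
    induction γ using Germ.inductionOn with | _ f
    rintro ⟨M, hM, hM'⟩
    refine ⟨fun q => (M q)⁻¹, ?_, fun p => (hM' p).inv⟩
    rw [Germ.map_coe, Germ.coe_eq] at hM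
    rw [← Germ.coe_inv, Germ.map_coe, Germ.coe_eq]
    filter_upwards [hM] with q h1
    simp only [Function.comp_apply] at h1
    simp [← h1]

/-- Negative loops: holomorphic at `∞`, with value the identity there. -/
def negativeLoops (n : ℕ) : Subgroup (LoopGerm n) where
  carrier := {γ | ∃ f : OnePoint ℂ → GL (Fin n) ℂ, γ = ↑f ∧
    HolomorphicAtPt (fun q => (f q : Matrix (Fin n) (Fin n) ℂ)) ∞ ∧ f ∞ = 1}
  one_mem' := ⟨1, rfl, HolomorphicAtPt.one, rfl⟩
  mul_mem' := by
    rintro _ _ ⟨f, rfl, hf, hf1⟩ ⟨g, rfl, hg, hg1⟩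
    exact ⟨f * g, rfl, hf.mul hg, by simp [hf1, hg1]⟩
  inv_mem' := by
    rintro _ ⟨f, rfl, hf, hf1⟩
    exact ⟨f⁻¹, rfl, HolomorphicAtPt.inv hf, by simp [hf1]⟩

/-- The antiholomorphic involution `τ(A) = conj A` (entrywise) of `GL(n, ℂ)`.  It restricts to the
complex group `G₂`, where its fixed point group is the compact real form. -/
noncomputable def conjGL (n : ℕ) : GL (Fin n) ℂ →* GL (Fin n) ℂ :=
  Matrix.GeneralLinearGroup.map (starRingEnd ℂ)

/-- Loops that satisfy the reality condition `τ(g(conj λ)) = g(λ)`. -/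
noncomputable def realLoops (n : ℕ) : Subgroup (LoopGerm n) where
  carrier := {γ | ∃ f : OnePoint ℂ → GL (Fin n) ℂ, γ = ↑f ∧
    ∀ᶠ p in denseOpen (OnePoint ℂ), conjGL n (f (OnePoint.map (starRingEnd ℂ) p)) = f p}
  one_mem' := ⟨1, rfl, Eventually.of_forall fun _ => by simp⟩
  mul_mem' := by
    rintro _ _ ⟨f, rfl, hf⟩ ⟨g, rfl, hg⟩
    refine ⟨f * g, rfl, ?_⟩
    filter_upwards [hf, hg] with p h1 h2
    simp [h1, h2]
  inv_mem' := by
    rintro _ ⟨f, rfl, hf⟩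
    refine ⟨f⁻¹, rfl, ?_⟩
    filter_upwards [hf] with p h1
    simp [h1]

/-- The negative rational real loop group `ℒ₋^τ(G, ℂⁿ)` of `G ⊆ GL(n, ℂ)`. -/
noncomputable def negRationalRealLoops {n : ℕ} (G : Subgroup (GL (Fin n) ℂ)) :
    Subgroup (LoopGerm n) :=
  holomorphicLoops G ⊓ rationalLoops n ⊓ negativeLoops n ⊓ realLoops n

/-! ### Complex coassociative planes and simple elements -/

/-- `ℂ⁷` with its standard hermitian inner product. -/
abbrev C7 : Type := EuclideanSpace ℂ (Fin 7)

/-- The complex conjugate of a subspace of `ℂ⁷`. -/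
def conjSubspace (W : Submodule ℂ C7) : Submodule ℂ C7 where
  carrier := {x | WithLp.toLp 2 (star x.ofLp) ∈ W}
  zero_mem' := by simp
  add_mem' := by
    intro x y hx hy
    simpa using W.add_mem hx hy
  smul_mem' := by
    intro c x hx
    simpa using W.smul_mem (star c) hx

/-- A complex coassociative plane: a two-dimensional subspace `W` of `ℂ⁷`, isotropic for the
complex bilinear form `⟨x, y⟩ = ∑ xᵢ yᵢ`, with `W · W = 0`. -/
structure IsComplexCoassociative (W : Submodule ℂ C7) : Prop where
  finrank_eq : Module.finrank ℂ W = 2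
  isotropic : ∀ x ∈ W, ∀ y ∈ W, x.ofLp ⬝ᵥ y.ofLp = 0
  imMul_eq_zero : ∀ x ∈ W, ∀ y ∈ W, imMul x.ofLp y.ofLp = 0

/-- The complex associative complement `(W ⊕ conj W)ᗮ`. -/
noncomputable def assocComplement (W : Submodule ℂ C7) : Submodule ℂ C7 := (W ⊔ conjSubspace W)ᗮ

/-- The matrix of the (hermitian) orthogonal projection onto `W`. -/
noncomputable def projMatrix (W : Submodule ℂ C7) : Matrix (Fin 7) (Fin 7) ℂ :=
  (Matrix.toEuclideanCLM (n := Fin 7) (𝕜 := ℂ)).symm W.starProjection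

/-- `r⁻¹ π_{conj W} + π_A + r π_W` with `A = (W ⊕ conj W)ᗮ`. -/
noncomputable def simpleMatrix (W : Submodule ℂ C7) (r : ℂ) : Matrix (Fin 7) (Fin 7) ℂ :=
  r⁻¹ • projMatrix (conjSubspace W) + projMatrix (assocComplement W) + r • projMatrix W

theorem projMatrix_mul_self (W : Submodule ℂ C7) : projMatrix W * projMatrix W = projMatrix W := by
  rw [projMatrix, ← map_mul]
  congr 1
  exact W.isIdempotentElem_starProjection

theorem projMatrix_mul_of_isOrtho {U W : Submodule ℂ C7} (h : U ⟂ W) :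
    projMatrix U * projMatrix W = 0 := by
  rw [projMatrix, projMatrix, ← map_mul]
  have : U.starProjection * W.starProjection = 0 := h.starProjection_comp_starProjection
  rw [this, map_zero]

theorem IsComplexCoassociative.isOrtho_conj {W : Submodule ℂ C7} (hW : IsComplexCoassociative W) :
    W ⟂ conjSubspace W := by
  rw [Submodule.isOrtho_iff_inner_eq]
  intro x hx y hy
  have h := hW.isotropic x hx _ hy
  have h2 : inner ℂ x y = star (x.ofLp ⬝ᵥ star y.ofLp) := by
    rw [EuclideanSpace.inner_eq_star_dotProduct]
    exact Matrix.dotProduct_star _ _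
  rw [h2, h, star_zero]

theorem IsComplexCoassociative.projMatrix_add {W : Submodule ℂ C7}
    (hW : IsComplexCoassociative W) :
    projMatrix (conjSubspace W) + projMatrix (assocComplement W) + projMatrix W = 1 := by
  have ho := hW.isOrtho_conj
  have key : (conjSubspace W).starProjection + (assocComplement W).starProjection
      + W.starProjection = 1 := by
    ext1 v
    have h1 : (W ⊔ conjSubspace W).starProjection v
        = W.starProjection v + (conjSubspace W).starProjection v := by
      refine Submodule.eq_starProjection_of_mem_of_inner_eq_zero ?_ ?_
      · exact Submodule.add_mem_sup (W.starProjection_apply_mem v)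
          ((conjSubspace W).starProjection_apply_mem v)
      · intro w hw
        obtain ⟨a, ha, b, hb, rfl⟩ := Submodule.mem_sup.mp hw
        have ea := W.starProjection_inner_eq_zero v a ha
        have eb := (conjSubspace W).starProjection_inner_eq_zero v b hb
        have ec := ho.symm.inner_eq ((conjSubspace W).starProjection_apply_mem v) ha
        have ed := ho.inner_eq (W.starProjection_apply_mem v) hb
        rw [inner_sub_left] at ea eb
        rw [inner_sub_left, inner_add_left, inner_add_right, inner_add_right, inner_add_right,
          ec, ed]
        linear_combination ea + eb
    have h2 := (W ⊔ conjSubspace W).starProjection_add_starProjection_orthogonal v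
    rw [h1] at h2
    change (conjSubspace W).starProjection v + ((W ⊔ conjSubspace W)ᗮ).starProjection v
      + W.starProjection v = v
    refine Eq.trans ?_ h2
    abel
  simp only [projMatrix, ← map_add, key, map_one]

theorem IsComplexCoassociative.simpleMatrix_mul_inv {W : Submodule ℂ C7}
    (hW : IsComplexCoassociative W) {r : ℂ} (hr : r ≠ 0) :
    simpleMatrix W r * simpleMatrix W r⁻¹ = 1 := by
  have ho := hW.isOrtho_conj
  have hA : W ⊔ conjSubspace W ⟂ assocComplement W := Submodule.isOrtho_orthogonal_right _
  have hWA : W ⟂ assocComplement W := hA.mono_left le_sup_left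
  have hCA : conjSubspace W ⟂ assocComplement W := hA.mono_left le_sup_right
  simp only [simpleMatrix, inv_inv, add_mul, mul_add, smul_mul_assoc, mul_smul_comm,
    projMatrix_mul_self, projMatrix_mul_of_isOrtho ho, projMatrix_mul_of_isOrtho ho.symm,
    projMatrix_mul_of_isOrtho hWA, projMatrix_mul_of_isOrtho hWA.symm,
    projMatrix_mul_of_isOrtho hCA, projMatrix_mul_of_isOrtho hCA.symm, smul_smul,
    mul_inv_cancel₀ hr, inv_mul_cancel₀ hr, smul_zero, one_smul, add_zero, zero_add]
  exact hW.projMatrix_add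

/-- `simpleMatrix` as an invertible matrix. -/
noncomputable def simpleGL (W : Submodule ℂ C7) (hW : IsComplexCoassociative W) (r : ℂ)
    (hr : r ≠ 0) : GL (Fin 7) ℂ where
  val := simpleMatrix W r
  inv := simpleMatrix W r⁻¹
  val_inv := hW.simpleMatrix_mul_inv hr
  inv_val := by simpa using hW.simpleMatrix_mul_inv (inv_ne_zero hr)

/-- The function `λ ↦ (λ - α) / (λ - conj α)` on `ℂP¹`, with value `1` at `∞`.  (It is only used
away from `α` and `conj α`.) -/
noncomputable def blaschke (α : ℂ) : OnePoint ℂ → ℂ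
  | ∞ => 1
  | (z : ℂ) => (z - α) / (z - starRingEnd ℂ α)

open Classical in
/-- The simple element
`p_{α,W}(λ) = (λ - conj α)/(λ - α) π_{conj W} + π_A + (λ - α)/(λ - conj α) π_W`,
which is defined for `λ ≠ α, conj α`; at these two points, which are irrelevant for the loop, the
value is set to `1`. -/
noncomputable def simpleElement (α : ℂ) (W : Submodule ℂ C7) (hW : IsComplexCoassociative W) :
    LoopGerm 7 :=
  ((fun p => if h : blaschke α p ≠ 0 then simpleGL W hW (blaschke α p) h else 1 :
    OnePoint ℂ → GL (Fin 7) ℂ) : LoopGerm 7)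

/-!
A rational loop in `G₂` has an entire numerator `H`, with denominator a product of factors
`(z - α) (z - conj α)`. At a zero `α` of the denominator the image of `H α` is isotropic and the
octonion product vanishes on it, so it has dimension at most two. The dimension of this image and
the derivative of `H` at `α` decide whether a single simple element lowers the order of the pole
at `α`. When none does, a first simple element rotates the leading coefficient `H α` so that a
second one lowers the order. Once no denominator is left, the loop is an entire matrix function
tending to `1` at infinity, hence constant by Liouville's theorem.
-/

open scoped ComplexConjugate Topology
open WithLp (toLp)

/-! ### The product of imaginary octonions -/

theorem funext_fin_seven {α : Type*} {x y : Fin 7 → α} (h0 : x 0 = y 0) (h1 : x 1 = y 1)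
    (h2 : x 2 = y 2) (h3 : x 3 = y 3) (h4 : x 4 = y 4) (h5 : x 5 = y 5) (h6 : x 6 = y 6) :
    x = y := by
  ext i
  fin_cases i <;> assumption

/-- The product `imMul` of imaginary octonions as a bilinear map. -/
def imMulBilin : (Fin 7 → ℂ) →ₗ[ℂ] (Fin 7 → ℂ) →ₗ[ℂ] (Fin 7 → ℂ) :=
  LinearMap.mk₂ ℂ imMul
    (fun x y z => by
      apply funext_fin_seven <;> simp only [imMul, Pi.add_apply, Matrix.cons_val] <;> ring)
    (fun c x y => by
      apply funext_fin_seven <;>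
        simp only [imMul, Pi.smul_apply, smul_eq_mul, Matrix.cons_val] <;> ring)
    (fun x y z => by
      apply funext_fin_seven <;> simp only [imMul, Pi.add_apply, Matrix.cons_val] <;> ring)
    (fun c x y => by
      apply funext_fin_seven <;>
        simp only [imMul, Pi.smul_apply, smul_eq_mul, Matrix.cons_val] <;> ring)

@[simp] theorem imMulBilin_apply (x y : Fin 7 → ℂ) : imMulBilin x y = imMul x y := rfl

theorem imMul_add (x y z : Fin 7 → ℂ) : imMul x (y + z) = imMul x y + imMul x z :=
  (imMulBilin x).map_add y z

theorem add_imMul (x y z : Fin 7 → ℂ) : imMul (x + y) z = imMul x z + imMul y z :=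
  imMulBilin.map_add₂ x y z

theorem imMul_smul (c : ℂ) (x y : Fin 7 → ℂ) : imMul x (c • y) = c • imMul x y :=
  (imMulBilin x).map_smul c y

theorem smul_imMul (c : ℂ) (x y : Fin 7 → ℂ) : imMul (c • x) y = c • imMul x y :=
  imMulBilin.map_smul₂ c x y

@[simp] theorem imMul_zero (x : Fin 7 → ℂ) : imMul x 0 = 0 := (imMulBilin x).map_zero

@[simp] theorem zero_imMul (x : Fin 7 → ℂ) : imMul 0 x = 0 := imMulBilin.map_zero₂ x

theorem imMul_neg (x y : Fin 7 → ℂ) : imMul x (-y) = -imMul x y := (imMulBilin x).map_neg y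

@[simp] theorem imMul_self (x : Fin 7 → ℂ) : imMul x x = 0 := by
  apply funext_fin_seven <;>
    simp only [imMul, Pi.zero_apply, Matrix.cons_val] <;> ring

theorem imMul_comm (x y : Fin 7 → ℂ) : imMul x y = -imMul y x := by
  apply funext_fin_seven <;>
    simp only [imMul, Pi.neg_apply, Matrix.cons_val] <;> ring

theorem imMul_star (x y : Fin 7 → ℂ) : imMul (star x) (star y) = star (imMul x y) := by
  apply funext_fin_seven <;>
    simp only [imMul, Pi.star_apply, star_add, star_sub, star_mul', Matrix.cons_val]

theorem dotProduct_imMul (x y z : Fin 7 → ℂ) : x ⬝ᵥ imMul y z = imMul x y ⬝ᵥ z := by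
  simp only [imMul, dotProduct, Fin.sum_univ_seven, Matrix.cons_val]
  ring

theorem imMul_imMul_add (x y z : Fin 7 → ℂ) : imMul x (imMul z y) + imMul z (imMul x y) =
    (-2 * (x ⬝ᵥ z)) • y + (x ⬝ᵥ y) • z + (z ⬝ᵥ y) • x := by
  apply funext_fin_seven <;>
    simp only [imMul, dotProduct, Fin.sum_univ_seven, Pi.add_apply, Pi.smul_apply,
      smul_eq_mul, Matrix.cons_val] <;> ring

theorem imMul_imMul_imMul (x a b : Fin 7 → ℂ) : imMul (imMul x a) (imMul x b) =
    (2 * (x ⬝ᵥ imMul a b)) • x - (x ⬝ᵥ x) • imMul a b - (x ⬝ᵥ b) • imMul x a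
      + (x ⬝ᵥ a) • imMul x b := by
  apply funext_fin_seven <;>
    simp only [imMul, dotProduct, Fin.sum_univ_seven, Pi.add_apply, Pi.sub_apply, Pi.smul_apply,
      smul_eq_mul, Matrix.cons_val] <;> ring

theorem imMul_imMul_self (x y : Fin 7 → ℂ) :
    imMul x (imMul x y) = (x ⬝ᵥ y) • x - (x ⬝ᵥ x) • y := by
  apply funext_fin_seven <;>
    simp only [imMul, dotProduct, Fin.sum_univ_seven, Pi.sub_apply, Pi.smul_apply,
      smul_eq_mul, Matrix.cons_val] <;> ring

theorem imMul_dotProduct (x y z : Fin 7 → ℂ) : imMul x y ⬝ᵥ z = -(y ⬝ᵥ imMul x z) := by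
  rw [dotProduct_imMul, imMul_comm x y, neg_dotProduct]

theorem dotProduct_imMul_self (x y : Fin 7 → ℂ) : x ⬝ᵥ imMul y x = 0 := by
  rw [imMul_comm, dotProduct_neg, dotProduct_imMul, imMul_self, zero_dotProduct, neg_zero]

theorem imMul_eq_zero_comm {x y : Fin 7 → ℂ} : imMul x y = 0 ↔ imMul y x = 0 := by
  rw [imMul_comm, neg_eq_zero]

/-! ### Null vectors and their annihilators -/

section LinearAlgebra

variable {K : Type*} [Field K]

theorem finrank_le_finrank_map_add_finrank_ker {V V' : Type*} [AddCommGroup V] [Module K V]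
    [FiniteDimensional K V] [AddCommGroup V'] [Module K V'] (f : V →ₗ[K] V') (S : Submodule K V) :
    Module.finrank K S ≤ Module.finrank K (S.map f) + Module.finrank K (LinearMap.ker f) := by
  have hker : Module.finrank K (LinearMap.ker (f.domRestrict S)) ≤
      Module.finrank K (LinearMap.ker f) := by
    rw [← Submodule.finrank_map_subtype_eq S]
    apply Submodule.finrank_mono
    rintro _ ⟨a, ha, rfl⟩
    exact ha
  have := (f.domRestrict S).finrank_range_add_finrank_ker
  rw [LinearMap.range_domRestrict] at this
  omega

variable {ι : Type*} [Fintype ι]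

theorem nondegenerate_dotProductBilin :
    (dotProductBilin K K : LinearMap.BilinForm K (ι → K)).Nondegenerate :=
  ⟨fun y hy => dotProduct_eq_zero y hy,
    fun y hy => dotProduct_eq_zero y fun w => by rw [dotProduct_comm]; exact hy w⟩

theorem two_mul_finrank_le_card_of_isotropic {S : Submodule K (ι → K)}
    (hS : ∀ y ∈ S, ∀ z ∈ S, y ⬝ᵥ z = 0) : 2 * Module.finrank K S ≤ Fintype.card ι := by
  have hle : S ≤ LinearMap.BilinForm.orthogonal (dotProductBilin K K) S :=
    fun y hy z hz => hS z hz y hy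
  have hfin := Submodule.finrank_mono hle
  rw [LinearMap.BilinForm.finrank_orthogonal nondegenerate_dotProductBilin,
    Module.finrank_fintype_fun_eq_card] at hfin
  have := S.finrank_le
  rw [Module.finrank_fintype_fun_eq_card] at this
  omega

theorem finrank_ker_dotProduct_add_one {x : ι → K} (hx : x ≠ 0) :
    Module.finrank K (LinearMap.ker (dotProductBilin K K x)) + 1 = Fintype.card ι := by
  rw [Module.Dual.finrank_ker_add_one_of_ne_zero, Module.finrank_fintype_fun_eq_card]
  exact fun h => hx (dotProduct_eq_zero x fun w => LinearMap.congr_fun h w)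

theorem mem_span_singleton_of_dotProduct {x y : ι → K} (h : ∀ b, x ⬝ᵥ b = 0 → y ⬝ᵥ b = 0) :
    y ∈ Submodule.span K {x} := by
  have hmem := mem_span_of_iInf_ker_le_ker (L := fun _ : Unit => dotProductBilin K K x)
    (K := dotProductBilin K K y) fun b hb => h b (by simpa using hb)
  obtain ⟨c, hc⟩ := Submodule.mem_span_singleton.mp (by simpa only [Set.range_const] using hmem)
  refine Submodule.mem_span_singleton.mpr ⟨c, sub_eq_zero.mp (dotProduct_eq_zero _ fun w => ?_)⟩
  have hw : c * (x ⬝ᵥ w) = y ⬝ᵥ w := LinearMap.congr_fun hc w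
  rw [sub_dotProduct, smul_dotProduct, smul_eq_mul, hw, sub_self]

end LinearAlgebra

section NullVector

variable {x : Fin 7 → ℂ}

theorem dotProduct_eq_zero_of_imMul_eq_zero (hx : x ≠ 0) (hxx : x ⬝ᵥ x = 0) {y : Fin 7 → ℂ}
    (hy : imMul x y = 0) : x ⬝ᵥ y = 0 := by
  have h := imMul_imMul_self x y
  rw [hy, hxx, imMul_zero, zero_smul, sub_zero] at h
  exact (smul_eq_zero.mp h.symm).resolve_right hx

/- Polarizing `x(xw) = ⟨x, w⟩ x - ⟨x, x⟩ w` once in each factor gives `x(zy) = ⟨z, y⟩ x` and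
`x(yz) = ⟨y, z⟩ x`, while the two left-hand sides are opposite. -/
theorem dotProduct_eq_zero_of_mem_annihilator (hx : x ≠ 0) (hxx : x ⬝ᵥ x = 0)
    {y z : Fin 7 → ℂ} (hy : imMul x y = 0) (hz : imMul x z = 0) : y ⬝ᵥ z = 0 := by
  have hxy := dotProduct_eq_zero_of_imMul_eq_zero hx hxx hy
  have hxz := dotProduct_eq_zero_of_imMul_eq_zero hx hxx hz
  have hzy : imMul x (imMul z y) = (y ⬝ᵥ z) • x := by
    simpa [hy, hxz, hxy, dotProduct_comm z y] using imMul_imMul_add x y z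
  have hyz : imMul x (imMul y z) = (y ⬝ᵥ z) • x := by
    simpa [hz, hxz, hxy] using imMul_imMul_add x z y
  rw [imMul_comm y z, imMul_neg, hzy] at hyz
  exact (smul_eq_zero.mp (self_eq_neg.mp hyz.symm)).resolve_right hx

theorem map_orthogonal_le_annihilator (hxx : x ⬝ᵥ x = 0) :
    (LinearMap.ker (dotProductBilin ℂ ℂ x)).map (imMulBilin x) ≤ LinearMap.ker (imMulBilin x) := by
  rintro _ ⟨a, ha, rfl⟩
  have ha' : x ⬝ᵥ a = 0 := ha
  simp [imMul_imMul_self, hxx, ha']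

theorem finrank_orthogonal (hx : x ≠ 0) :
    Module.finrank ℂ (LinearMap.ker (dotProductBilin ℂ ℂ x)) = 6 := by
  simpa using finrank_ker_dotProduct_add_one hx

theorem finrank_annihilator (hx : x ≠ 0) (hxx : x ⬝ᵥ x = 0) :
    Module.finrank ℂ (LinearMap.ker (imMulBilin x)) = 3 := by
  have hupper := two_mul_finrank_le_card_of_isotropic (S := LinearMap.ker (imMulBilin x))
    fun y hy z hz => dotProduct_eq_zero_of_mem_annihilator hx hxx hy hz
  have hlower := finrank_le_finrank_map_add_finrank_ker (imMulBilin x)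
    (LinearMap.ker (dotProductBilin ℂ ℂ x))
  have hle := Submodule.finrank_mono (map_orthogonal_le_annihilator hxx)
  rw [finrank_orthogonal hx] at hlower
  rw [Fintype.card_fin] at hupper
  omega

theorem map_orthogonal_eq_annihilator (hx : x ≠ 0) (hxx : x ⬝ᵥ x = 0) :
    (LinearMap.ker (dotProductBilin ℂ ℂ x)).map (imMulBilin x) = LinearMap.ker (imMulBilin x) := by
  apply Submodule.eq_of_le_of_finrank_le (map_orthogonal_le_annihilator hxx)
  have h := finrank_le_finrank_map_add_finrank_ker (imMulBilin x)
    (LinearMap.ker (dotProductBilin ℂ ℂ x))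
  rw [finrank_orthogonal hx, finrank_annihilator hx hxx] at h
  rw [finrank_annihilator hx hxx]
  omega

theorem exists_imMul_eq (hx : x ≠ 0) (hxx : x ⬝ᵥ x = 0) {y : Fin 7 → ℂ} (hy : imMul x y = 0) :
    ∃ a, x ⬝ᵥ a = 0 ∧ imMul x a = y :=
  (map_orthogonal_eq_annihilator hx hxx).ge hy

theorem exists_mem_annihilator (hx : x ≠ 0) (hxx : x ⬝ᵥ x = 0) (f g : (Fin 7 → ℂ) →ₗ[ℂ] ℂ) :
    ∃ v ≠ 0, imMul x v = 0 ∧ f v = 0 ∧ g v = 0 := by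
  have h : LinearMap.ker ((f.prod g).domRestrict (LinearMap.ker (imMulBilin x))) ≠ ⊥ := by
    apply LinearMap.ker_ne_bot_of_finrank_lt
    rw [finrank_annihilator hx hxx, Module.finrank_prod, Module.finrank_self]
    norm_num
  obtain ⟨⟨v, hv⟩, hfg, hv0⟩ := Submodule.exists_mem_ne_zero_of_ne_bot h
  obtain ⟨hf, hg⟩ := Prod.mk_eq_zero.mp (show (f v, g v) = 0 from hfg)
  exact ⟨v, fun h => hv0 (by simp [h]), hv, hf, hg⟩

theorem imMul_mem_span_of_orthogonal_annihilator (hxx : x ⬝ᵥ x = 0) {a : Fin 7 → ℂ}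
    (ha : ∀ n, imMul x n = 0 → a ⬝ᵥ n = 0) : imMul x a ∈ Submodule.span ℂ {x} :=
  mem_span_singleton_of_dotProduct fun w hw => by
    rw [imMul_dotProduct, ha _ (by simp [imMul_imMul_self, hxx, hw]), neg_zero]

theorem mem_span_pair_of_imMul_eq_zero (hxx : x ⬝ᵥ x = 0) {y z : Fin 7 → ℂ}
    (hli : LinearIndependent ℂ ![x, y]) (hxy : imMul x y = 0) (hxz : imMul x z = 0)
    (hyz : imMul y z = 0) : z ∈ Submodule.span ℂ {x, y} := by
  have hx : x ≠ 0 := hli.ne_zero 0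
  by_contra hz
  have hli' : LinearIndependent ℂ ![z, x, y] :=
    linearIndependent_finCons.mpr ⟨hli, by rwa [Matrix.range_cons_cons_empty]⟩
  have hspan : Submodule.span ℂ (Set.range ![z, x, y]) = LinearMap.ker (imMulBilin x) := by
    apply Submodule.eq_of_le_of_finrank_eq
    · rw [Submodule.span_le]
      rintro _ ⟨i, rfl⟩
      fin_cases i <;> simp [hxy, hxz]
    · rw [finrank_annihilator hx hxx, finrank_span_eq_card hli', Fintype.card_fin]
  obtain ⟨a, ha, rfl⟩ := exists_imMul_eq hx hxx hxy
  obtain ⟨b, hb, rfl⟩ := exists_imMul_eq hx hxx hxz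
  have hab : x ⬝ᵥ imMul a b = 0 := by
    rw [imMul_imMul_imMul, hxx, ha, hb] at hyz
    simpa [hx] using hyz
  have horth : LinearMap.ker (imMulBilin x) ≤ LinearMap.ker (dotProductBilin ℂ ℂ a) := by
    rw [← hspan, Submodule.span_le]
    rintro _ ⟨i, rfl⟩
    have haz : a ⬝ᵥ imMul x b = 0 := by
      rw [dotProduct_imMul, imMul_comm, neg_dotProduct, ← dotProduct_imMul, hab, neg_zero]
    fin_cases i
    exacts [haz, (dotProduct_comm a x).trans ha, dotProduct_imMul_self a x]
  obtain ⟨c, hc⟩ := Submodule.mem_span_singleton.mp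
    (imMul_mem_span_of_orthogonal_annihilator hxx fun n hn => horth hn)
  exact (LinearIndependent.pair_iff' hx).mp hli c hc

theorem exists_dotProduct_imMul_ne_zero (hx : x ≠ 0) :
    ∃ y z, x ⬝ᵥ y = 0 ∧ x ⬝ᵥ z = 0 ∧ x ⬝ᵥ imMul y z ≠ 0 := by
  by_contra! h
  have hmul : ∀ y, x ⬝ᵥ y = 0 → imMul x y ∈ Submodule.span ℂ {x} := fun y hy =>
    mem_span_singleton_of_dotProduct fun z hz => by rw [← dotProduct_imMul, h y z hy hz]
  have hxx : x ⬝ᵥ x = 0 := by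
    have hne : LinearMap.ker (dotProductBilin ℂ ℂ x) ≠ ⊥ := by
      rw [Ne, ← Submodule.finrank_eq_zero, finrank_orthogonal hx]
      norm_num
    obtain ⟨y, hy, hy0⟩ := Submodule.exists_mem_ne_zero_of_ne_bot hne
    obtain ⟨c, hc⟩ := Submodule.mem_span_singleton.mp (hmul y hy)
    have hsq := imMul_imMul_self x y
    rw [← hc, imMul_smul, imMul_self, show x ⬝ᵥ y = 0 from hy] at hsq
    simpa [hy0] using hsq.symm
  have hle : (LinearMap.ker (dotProductBilin ℂ ℂ x)).map (imMulBilin x) ≤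
      Submodule.span ℂ {x} := by
    rintro _ ⟨a, ha, rfl⟩
    exact hmul a ha
  have himage := Submodule.finrank_mono hle
  have hdim := finrank_le_finrank_map_add_finrank_ker (imMulBilin x)
    (LinearMap.ker (dotProductBilin ℂ ℂ x))
  rw [finrank_span_singleton hx] at himage
  rw [finrank_orthogonal hx, finrank_annihilator hx hxx] at hdim
  omega

end NullVector

/-! ### Orthogonal projections in coordinates -/

open scoped ComplexOrder in
theorem star_dotProduct_self_ne_zero {n : Type*} [Fintype n] {x : n → ℂ} (hx : x ≠ 0) :
    star x ⬝ᵥ x ≠ 0 :=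
  fun h => hx (dotProduct_star_self_eq_zero.mp h)

section Projections

variable {W : Submodule ℂ C7} {v : Fin 7 → ℂ}

theorem projMatrix_mulVec (W : Submodule ℂ C7) (v : Fin 7 → ℂ) :
    projMatrix W *ᵥ v = (W.starProjection (toLp 2 v)).ofLp := by
  rw [projMatrix, ← Matrix.ofLp_toEuclideanCLM _ (toLp 2 v), StarAlgEquiv.apply_symm_apply]

theorem projMatrix_mulVec_mem (W : Submodule ℂ C7) (v : Fin 7 → ℂ) :
    toLp 2 (projMatrix W *ᵥ v) ∈ W := by
  rw [projMatrix_mulVec]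
  exact W.starProjection_apply_mem _

theorem projMatrix_mulVec_of_mem (hv : toLp 2 v ∈ W) : projMatrix W *ᵥ v = v := by
  rw [projMatrix_mulVec, Submodule.starProjection_eq_self_iff.mpr hv]

theorem projMatrix_mulVec_eq_zero (hv : ∀ w, toLp 2 w ∈ W → star w ⬝ᵥ v = 0) :
    projMatrix W *ᵥ v = 0 := by
  rw [projMatrix_mulVec, (Submodule.starProjection_apply_eq_zero_iff W).mpr, WithLp.ofLp_zero]
  rw [Submodule.mem_orthogonal]
  intro u hu
  rw [EuclideanSpace.inner_eq_star_dotProduct, dotProduct_comm]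
  exact hv _ hu

theorem projMatrix_mulVec_eq {s : Fin 7 → ℂ} (hs : toLp 2 s ∈ W)
    (h : ∀ w, toLp 2 w ∈ W → star w ⬝ᵥ (v - s) = 0) : projMatrix W *ᵥ v = s := by
  have h0 := projMatrix_mulVec_eq_zero h
  rwa [Matrix.mulVec_sub, projMatrix_mulVec_of_mem hs, sub_eq_zero] at h0

theorem toLp_mem_conjSubspace : toLp 2 v ∈ conjSubspace W ↔ toLp 2 (star v) ∈ W := Iff.rfl

theorem toLp_star_mem_conjSubspace : toLp 2 (star v) ∈ conjSubspace W ↔ toLp 2 v ∈ W := by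
  rw [toLp_mem_conjSubspace, star_star]

theorem toLp_mem_assocComplement : toLp 2 v ∈ assocComplement W ↔
    ∀ w, toLp 2 w ∈ W → w ⬝ᵥ v = 0 ∧ star w ⬝ᵥ v = 0 := by
  rw [assocComplement, ← Submodule.inf_orthogonal, Submodule.mem_inf, Submodule.mem_orthogonal,
    Submodule.mem_orthogonal]
  simp only [EuclideanSpace.inner_eq_star_dotProduct, dotProduct_comm v]
  refine ⟨fun ⟨h, h'⟩ w hw => ⟨?_, h (toLp 2 w) hw⟩, fun h =>
    ⟨fun u hu => (h u.ofLp hu).2, fun u hu => (h (star u.ofLp) hu).1⟩⟩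
  simpa using h' (toLp 2 (star w)) (toLp_star_mem_conjSubspace.mpr hw)

theorem star_mem_assocComplement (hv : toLp 2 v ∈ assocComplement W) :
    toLp 2 (star v) ∈ assocComplement W := by
  rw [toLp_mem_assocComplement] at hv ⊢
  intro w hw
  obtain ⟨hwv, hwv'⟩ := hv w hw
  exact ⟨by rw [← star_star w, Matrix.star_dotProduct_star, dotProduct_comm, hwv', star_zero],
    by rw [Matrix.star_dotProduct_star, dotProduct_comm, hwv, star_zero]⟩

theorem projMatrix_conjSubspace_mulVec_eq_zero (hv : ∀ w, toLp 2 w ∈ W → w ⬝ᵥ v = 0) :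
    projMatrix (conjSubspace W) *ᵥ v = 0 :=
  projMatrix_mulVec_eq_zero fun _ hw => hv _ hw

theorem projMatrix_assocComplement_mulVec_of_mem (hv : toLp 2 v ∈ W) :
    projMatrix (assocComplement W) *ᵥ v = 0 :=
  projMatrix_mulVec_eq_zero fun w hw => by
    rw [Matrix.star_dotProduct, (toLp_mem_assocComplement.mp hw v hv).2, star_zero]

theorem projMatrix_assocComplement_mulVec_of_mem_conj (hv : toLp 2 v ∈ conjSubspace W) :
    projMatrix (assocComplement W) *ᵥ v = 0 :=
  projMatrix_mulVec_eq_zero fun w hw => by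
    rw [Matrix.star_dotProduct, (toLp_mem_assocComplement.mp hw _ hv).1, star_zero]

theorem simpleMatrix_mulVec (W : Submodule ℂ C7) (r : ℂ) (v : Fin 7 → ℂ) :
    simpleMatrix W r *ᵥ v = r⁻¹ • projMatrix (conjSubspace W) *ᵥ v
      + projMatrix (assocComplement W) *ᵥ v + r • projMatrix W *ᵥ v := by
  simp only [simpleMatrix, Matrix.add_mulVec, Matrix.smul_mulVec]

theorem simpleMatrix_mulVec_of_mem_assocComplement (r : ℂ) (hv : toLp 2 v ∈ assocComplement W) :
    simpleMatrix W r *ᵥ v = v := by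
  have h := toLp_mem_assocComplement.mp hv
  rw [simpleMatrix_mulVec, projMatrix_mulVec_of_mem hv,
    projMatrix_conjSubspace_mulVec_eq_zero fun w hw => (h w hw).1,
    projMatrix_mulVec_eq_zero (W := W) fun w hw => (h w hw).2, smul_zero, smul_zero, zero_add,
    add_zero]

theorem star_dotProduct_sub_projMatrix_mulVec (v : Fin 7 → ℂ) {w : Fin 7 → ℂ}
    (hw : toLp 2 w ∈ W) : star w ⬝ᵥ (v - projMatrix W *ᵥ v) = 0 := by
  have h := W.starProjection_inner_eq_zero (toLp 2 v) _ hw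
  rwa [Matrix.star_dotProduct, dotProduct_comm, projMatrix_mulVec, star_eq_zero]

theorem map_conj_smul {m n : Type*} (c : ℂ) (A : Matrix m n ℂ) :
    (c • A).map conj = conj c • A.map conj :=
  Matrix.map_smulₛₗ _ _ _ (by simp) _

theorem map_conj_mulVec {m n : Type*} [Fintype n] (A : Matrix m n ℂ) (v : n → ℂ) :
    A.map conj *ᵥ v = star (A *ᵥ star v) := by
  ext i
  simp [Matrix.mulVec, dotProduct]

theorem projMatrix_map_conj (W : Submodule ℂ C7) :
    (projMatrix W).map conj = projMatrix (conjSubspace W) := by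
  refine Matrix.ext_iff_mulVec.mpr fun v => ?_
  rw [map_conj_mulVec]
  refine (projMatrix_mulVec_eq ?_ fun w hw => ?_).symm
  · exact toLp_star_mem_conjSubspace.mpr (projMatrix_mulVec_mem W _)
  · rw [← star_eq_zero, ← star_dotProduct_sub_projMatrix_mulVec (star v)
      (toLp_mem_conjSubspace.mp hw), Matrix.star_dotProduct, star_star, star_star, star_sub,
      star_star, dotProduct_comm]

theorem conjSubspace_conjSubspace (W : Submodule ℂ C7) : conjSubspace (conjSubspace W) = W :=
  Submodule.ext fun x => by
    rw [← WithLp.toLp_ofLp 2 x, toLp_mem_conjSubspace, toLp_star_mem_conjSubspace]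

theorem conjSubspace_assocComplement (W : Submodule ℂ C7) :
    conjSubspace (assocComplement W) = assocComplement W :=
  Submodule.ext fun x =>
    ⟨fun h => by simpa using star_mem_assocComplement h, fun h => star_mem_assocComplement h⟩

theorem simpleMatrix_map_conj (W : Submodule ℂ C7) (r : ℂ) :
    (simpleMatrix W r).map conj = simpleMatrix W (conj r)⁻¹ := by
  simp only [simpleMatrix, Matrix.map_add _ (map_add _), map_conj_smul, projMatrix_map_conj,
    conjSubspace_conjSubspace, conjSubspace_assocComplement, inv_inv, map_inv₀]
  abel

end Projections

/-! ### The grading defined by a complex coassociative plane -/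

namespace IsComplexCoassociative

variable {W : Submodule ℂ C7} {a b c d : Fin 7 → ℂ}

section
variable (hW : IsComplexCoassociative W)
include hW

theorem dotProduct_mem_mem (hc : toLp 2 c ∈ W) (hd : toLp 2 d ∈ W) : c ⬝ᵥ d = 0 :=
  hW.isotropic _ hc _ hd

theorem dotProduct_conj_conj (hc : toLp 2 c ∈ conjSubspace W)
    (hd : toLp 2 d ∈ conjSubspace W) : c ⬝ᵥ d = 0 := by
  have h := hW.dotProduct_mem_mem hc hd
  rwa [Matrix.star_dotProduct_star, star_eq_zero, dotProduct_comm] at h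

theorem imMul_mem_mem (hc : toLp 2 c ∈ W) (hd : toLp 2 d ∈ W) : imMul c d = 0 :=
  hW.imMul_eq_zero _ hc _ hd

theorem imMul_conj_conj (hc : toLp 2 c ∈ conjSubspace W) (hd : toLp 2 d ∈ conjSubspace W) :
    imMul c d = 0 := by
  have h := hW.imMul_mem_mem hc hd
  rwa [imMul_star, star_eq_zero] at h

theorem exists_linearIndependent_pair (hc : toLp 2 c ∈ W) (hc0 : c ≠ 0) :
    ∃ d, toLp 2 d ∈ W ∧ LinearIndependent ℂ ![c, d] := by
  obtain ⟨d, hd⟩ := exists_linearIndependent_pair_of_one_lt_finrank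
    (by rw [hW.finrank_eq]; norm_num) (show (⟨toLp 2 c, hc⟩ : W) ≠ 0 by simpa using hc0)
  refine ⟨d.1.ofLp, d.2, (LinearIndependent.pair_iff' hc0).mpr fun p hp => ?_⟩
  exact (LinearIndependent.pair_iff' (by simpa using hc0)).mp hd p
    (Subtype.ext (congrArg (toLp 2) hp))

theorem mem_of_imMul_eq_zero (ha : ∀ w, toLp 2 w ∈ W → imMul w a = 0) : toLp 2 a ∈ W := by
  obtain ⟨c, hc, hc0⟩ := Submodule.exists_mem_ne_zero_of_ne_bot
    (show W ≠ ⊥ by rintro rfl; simpa using hW.finrank_eq)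
  obtain ⟨d, hd, hli⟩ := hW.exists_linearIndependent_pair (c := c.ofLp) hc (by simpa using hc0)
  obtain ⟨s, t, rfl⟩ := Submodule.mem_span_pair.mp <|
    mem_span_pair_of_imMul_eq_zero (hW.dotProduct_mem_mem hc hc) hli (hW.imMul_mem_mem hc hd)
      (ha _ hc) (ha d hd)
  exact W.add_mem (W.smul_mem s hc) (W.smul_mem t hd)

theorem imMul_imMul_mem (hc : toLp 2 c ∈ W) (hd : toLp 2 d ∈ W) (b : Fin 7 → ℂ) :
    toLp 2 (imMul c (imMul d b)) ∈ W := by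
  by_cases hli : LinearIndependent ℂ ![c, d]
  · have hcc : imMul c (imMul c (imMul d b)) = 0 := by
      rw [imMul_imMul_self, dotProduct_imMul, hW.imMul_mem_mem hc hd, zero_dotProduct,
        hW.dotProduct_mem_mem hc hc, zero_smul, zero_smul, sub_zero]
    have hdc : imMul d (imMul c (imMul d b)) = 0 := by
      simpa [imMul_imMul_self d b, imMul_smul, dotProduct_imMul, hW.imMul_mem_mem hc hd,
        hW.dotProduct_mem_mem hd hc, hW.dotProduct_mem_mem hd hd]
        using imMul_imMul_add d (imMul d b) c
    obtain ⟨s, t, hst⟩ := Submodule.mem_span_pair.mp <| mem_span_pair_of_imMul_eq_zero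
      (hW.dotProduct_mem_mem hc hc) hli (hW.imMul_mem_mem hc hd) hcc hdc
    rw [← hst]
    exact W.add_mem (W.smul_mem s hc) (W.smul_mem t hd)
  · by_cases hc0 : c = 0
    · simp [hc0]
    rw [LinearIndependent.pair_iff' hc0] at hli
    push Not at hli
    obtain ⟨p, rfl⟩ := hli
    rw [smul_imMul, imMul_smul, imMul_imMul_self, hW.dotProduct_mem_mem hc hc, zero_smul, sub_zero]
    exact W.smul_mem _ (W.smul_mem _ hc)

theorem imMul_mem (hc : toLp 2 c ∈ W) (ha : ∀ w, toLp 2 w ∈ W → w ⬝ᵥ a = 0) :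
    toLp 2 (imMul c a) ∈ W :=
  hW.mem_of_imMul_eq_zero fun w hw => dotProduct_eq_zero _ fun b => by
    rw [imMul_dotProduct, imMul_dotProduct, neg_neg, dotProduct_comm,
      ha _ (hW.imMul_imMul_mem hc hw b)]

theorem imMul_mem_assoc (hc : toLp 2 c ∈ W) (ha : toLp 2 a ∈ assocComplement W) :
    toLp 2 (imMul c a) ∈ W :=
  hW.imMul_mem hc fun w hw => (toLp_mem_assocComplement.mp ha w hw).1

theorem imMul_conj_assoc (hd : toLp 2 d ∈ conjSubspace W) (ha : toLp 2 a ∈ assocComplement W) :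
    toLp 2 (imMul d a) ∈ conjSubspace W := by
  rw [toLp_mem_conjSubspace, ← imMul_star]
  exact hW.imMul_mem_assoc hd (star_mem_assocComplement ha)

theorem imMul_assoc_assoc (ha : toLp 2 a ∈ assocComplement W) (hb : toLp 2 b ∈ assocComplement W) :
    toLp 2 (imMul a b) ∈ assocComplement W := by
  refine toLp_mem_assocComplement.mpr fun w hw => ⟨?_, ?_⟩
  · rw [dotProduct_imMul, (toLp_mem_assocComplement.mp hb _ (hW.imMul_mem_assoc hw ha)).1]
  · rw [dotProduct_imMul, ← star_star (imMul (star w) a),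
      (toLp_mem_assocComplement.mp hb _
        (hW.imMul_conj_assoc (toLp_star_mem_conjSubspace.mpr hw) ha)).2]

theorem imMul_mem_conj (hc : toLp 2 c ∈ W) (hd : toLp 2 d ∈ conjSubspace W) :
    toLp 2 (imMul c d) ∈ assocComplement W := by
  refine toLp_mem_assocComplement.mpr fun w hw => ⟨?_, ?_⟩
  · rw [dotProduct_imMul, hW.imMul_mem_mem hw hc, zero_dotProduct]
  · rw [dotProduct_comm, ← dotProduct_imMul,
      hW.imMul_conj_conj hd (toLp_star_mem_conjSubspace.mpr hw), dotProduct_zero]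

theorem projMatrix_decomp (v : Fin 7 → ℂ) : projMatrix (conjSubspace W) *ᵥ v
    + projMatrix (assocComplement W) *ᵥ v + projMatrix W *ᵥ v = v := by
  rw [← Matrix.add_mulVec, ← Matrix.add_mulVec, hW.projMatrix_add, Matrix.one_mulVec]

theorem induction {P : (Fin 7 → ℂ) → Prop} (hconj : ∀ v, toLp 2 v ∈ conjSubspace W → P v)
    (hassoc : ∀ v, toLp 2 v ∈ assocComplement W → P v) (hmem : ∀ v, toLp 2 v ∈ W → P v)
    (hadd : ∀ u v, P u → P v → P (u + v)) (v : Fin 7 → ℂ) : P v := by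
  rw [← hW.projMatrix_decomp v]
  exact hadd _ _ (hadd _ _ (hconj _ (projMatrix_mulVec_mem _ v))
    (hassoc _ (projMatrix_mulVec_mem _ v))) (hmem _ (projMatrix_mulVec_mem _ v))

theorem induction₂ {P : (Fin 7 → ℂ) → (Fin 7 → ℂ) → Prop}
    (conj_conj : ∀ u v, toLp 2 u ∈ conjSubspace W → toLp 2 v ∈ conjSubspace W → P u v)
    (conj_assoc : ∀ u v, toLp 2 u ∈ conjSubspace W → toLp 2 v ∈ assocComplement W → P u v)
    (assoc_assoc : ∀ u v, toLp 2 u ∈ assocComplement W → toLp 2 v ∈ assocComplement W → P u v)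
    (mem_conj : ∀ u v, toLp 2 u ∈ W → toLp 2 v ∈ conjSubspace W → P u v)
    (mem_assoc : ∀ u v, toLp 2 u ∈ W → toLp 2 v ∈ assocComplement W → P u v)
    (mem_mem : ∀ u v, toLp 2 u ∈ W → toLp 2 v ∈ W → P u v)
    (symm : ∀ u v, P u v → P v u) (add_right : ∀ u v v', P u v → P u v' → P u (v + v'))
    (u v : Fin 7 → ℂ) : P u v :=
  hW.induction (P := fun u => ∀ v, P u v)
    (fun u hu => hW.induction (conj_conj u · hu) (conj_assoc u · hu)
      (fun v hv => symm _ _ (mem_conj v u hv hu)) (add_right u))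
    (fun u hu => hW.induction (fun v hv => symm _ _ (conj_assoc v u hv hu)) (assoc_assoc u · hu)
      (fun v hv => symm _ _ (mem_assoc v u hv hu)) (add_right u))
    (fun u hu => hW.induction (mem_conj u · hu) (mem_assoc u · hu) (mem_mem u · hu) (add_right u))
    (fun _ _ hu hu' v => symm _ _ (add_right _ _ _ (symm _ _ (hu v)) (symm _ _ (hu' v)))) u v

theorem simpleMatrix_mulVec_of_mem (r : ℂ) (hc : toLp 2 c ∈ W) :
    simpleMatrix W r *ᵥ c = r • c := by
  rw [simpleMatrix_mulVec, projMatrix_assocComplement_mulVec_of_mem hc,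
    projMatrix_mulVec_of_mem hc,
    projMatrix_conjSubspace_mulVec_eq_zero fun w hw => hW.dotProduct_mem_mem hw hc, smul_zero,
    zero_add, zero_add]

theorem simpleMatrix_mulVec_of_mem_conj (r : ℂ) (hd : toLp 2 d ∈ conjSubspace W) :
    simpleMatrix W r *ᵥ d = r⁻¹ • d := by
  rw [simpleMatrix_mulVec, projMatrix_mulVec_of_mem hd,
    projMatrix_assocComplement_mulVec_of_mem_conj hd, projMatrix_mulVec_eq_zero (W := W),
    smul_zero, add_zero, add_zero]
  exact fun w hw =>
    hW.dotProduct_conj_conj (toLp_star_mem_conjSubspace.mpr hw) hd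

theorem simpleMatrix_imMul {r : ℂ} (hr : r ≠ 0) (u v : Fin 7 → ℂ) :
    simpleMatrix W r *ᵥ imMul u v = imMul (simpleMatrix W r *ᵥ u) (simpleMatrix W r *ᵥ v) := by
  have hS {u} := hW.simpleMatrix_mulVec_of_mem (c := u) r
  have hSc {u} := hW.simpleMatrix_mulVec_of_mem_conj (d := u) r
  have hSa {u} := simpleMatrix_mulVec_of_mem_assocComplement (W := W) (v := u) r
  induction u, v using hW.induction₂ with
  | conj_conj c d hc hd => simp [hW.imMul_conj_conj hc hd, hSc hc, hSc hd, smul_imMul, imMul_smul]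
  | conj_assoc d a hd ha => rw [hSc hd, hSa ha, smul_imMul, hSc (hW.imMul_conj_assoc hd ha)]
  | assoc_assoc a b ha hb => rw [hSa ha, hSa hb, hSa (hW.imMul_assoc_assoc ha hb)]
  | mem_conj c d hc hd =>
    rw [hS hc, hSc hd, smul_imMul, imMul_smul, smul_inv_smul₀ hr, hSa (hW.imMul_mem_conj hc hd)]
  | mem_assoc c a hc ha => rw [hS hc, hSa ha, smul_imMul, hS (hW.imMul_mem_assoc hc ha)]
  | mem_mem c d hc hd => simp [hW.imMul_mem_mem hc hd, hS hc, hS hd, smul_imMul, imMul_smul]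
  | symm u v h => rw [imMul_comm v, imMul_comm (_ *ᵥ v), Matrix.mulVec_neg, h]
  | add_right u v v' h h' =>
    rw [Matrix.mulVec_add, imMul_add, imMul_add, Matrix.mulVec_add, h, h']

theorem simpleMatrix_dotProduct {r : ℂ} (hr : r ≠ 0) (u v : Fin 7 → ℂ) :
    (simpleMatrix W r *ᵥ u) ⬝ᵥ (simpleMatrix W r *ᵥ v) = u ⬝ᵥ v := by
  have hS {u} := hW.simpleMatrix_mulVec_of_mem (c := u) r
  have hSc {u} := hW.simpleMatrix_mulVec_of_mem_conj (d := u) r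
  have hSa {u} := simpleMatrix_mulVec_of_mem_assocComplement (W := W) (v := u) r
  induction u, v using hW.induction₂ with
  | conj_conj c d hc hd => simp [hSc hc, hSc hd, hW.dotProduct_conj_conj hc hd]
  | conj_assoc d a hd ha =>
    have hda : d ⬝ᵥ a = 0 := by simpa using (toLp_mem_assocComplement.mp ha _ hd).2
    rw [hSc hd, hSa ha, smul_dotProduct, hda, smul_zero]
  | assoc_assoc a b ha hb => rw [hSa ha, hSa hb]
  | mem_conj c d hc hd =>
    rw [hS hc, hSc hd, smul_dotProduct, dotProduct_smul, smul_inv_smul₀ hr]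
  | mem_assoc c a hc ha =>
    rw [hS hc, hSa ha, smul_dotProduct, (toLp_mem_assocComplement.mp ha c hc).1, smul_zero]
  | mem_mem c d hc hd => simp [hS hc, hS hd, hW.dotProduct_mem_mem hc hd]
  | symm u v h => rw [dotProduct_comm, h, dotProduct_comm]
  | add_right u v v' h h' => rw [Matrix.mulVec_add, dotProduct_add, dotProduct_add, h, h']

end

end IsComplexCoassociative

/-- The linear map `id ⊕ A` is an automorphism of `𝕆 ⊗ ℂ`.  Invertibility of `A`, which membership
in `complexG2` presupposes, is a consequence: see `IsG2Matrix.isUnit`. -/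
structure IsG2Matrix (A : Matrix (Fin 7) (Fin 7) ℂ) : Prop where
  dotProduct_eq : ∀ u v, (A *ᵥ u) ⬝ᵥ (A *ᵥ v) = u ⬝ᵥ v
  mulVec_imMul : ∀ u v, A *ᵥ imMul u v = imMul (A *ᵥ u) (A *ᵥ v)

namespace IsG2Matrix

variable {A B : Matrix (Fin 7) (Fin 7) ℂ}

theorem mul (hA : IsG2Matrix A) (hB : IsG2Matrix B) : IsG2Matrix (A * B) where
  dotProduct_eq u v := by
    rw [← Matrix.mulVec_mulVec, ← Matrix.mulVec_mulVec, hA.dotProduct_eq, hB.dotProduct_eq]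
  mulVec_imMul u v := by
    simp only [← Matrix.mulVec_mulVec, hA.mulVec_imMul, hB.mulVec_imMul]

theorem isUnit (hA : IsG2Matrix A) : IsUnit A := by
  rw [← Matrix.mulVec_injective_iff_isUnit]
  intro u v (huv : A *ᵥ u = A *ᵥ v)
  refine sub_eq_zero.mp (dotProduct_eq_zero _ fun w => ?_)
  rw [← hA.dotProduct_eq, Matrix.mulVec_sub, huv, sub_self, zero_dotProduct]

end IsG2Matrix

theorem mem_complexG2_iff {A : GL (Fin 7) ℂ} : A ∈ complexG2 ↔ IsG2Matrix A := by
  constructor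
  · intro h
    have h' : ∀ u v : Fin 7 → ℂ, _ := fun u v => h (0, u) (0, v)
    simp only [octExtend, octMul, Prod.mk.injEq, mul_zero, zero_sub, zero_smul, zero_add,
      neg_inj] at h'
    exact ⟨fun u v => (h' u v).1.symm, fun u v => (h' u v).2⟩
  · intro h p q
    simp only [octExtend, octMul, h.dotProduct_eq, Matrix.mulVec_add, Matrix.mulVec_smul,
      h.mulVec_imMul]

theorem IsComplexCoassociative.isG2Matrix_simpleMatrix {W : Submodule ℂ C7}
    (hW : IsComplexCoassociative W) {r : ℂ} (hr : r ≠ 0) : IsG2Matrix (simpleMatrix W r) :=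
  ⟨hW.simpleMatrix_dotProduct hr, hW.simpleMatrix_imMul hr⟩

theorem toLp_mem_span_pair {x y w : Fin 7 → ℂ} :
    toLp 2 w ∈ Submodule.span ℂ {(toLp 2 x : C7), toLp 2 y} ↔ w ∈ Submodule.span ℂ {x, y} := by
  simp only [Submodule.mem_span_pair]
  exact exists₂_congr fun a b => (WithLp.toLp_injective 2).eq_iff

theorem isComplexCoassociative_span_pair {x c : Fin 7 → ℂ} (hxx : x ⬝ᵥ x = 0)
    (hxc : imMul x c = 0) (hli : LinearIndependent ℂ ![x, c]) :
    IsComplexCoassociative (Submodule.span ℂ {toLp 2 x, toLp 2 c}) where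
  finrank_eq := by
    have hlin : LinearIndependent ℂ ![(toLp 2 x : C7), toLp 2 c] := by
      rw [LinearIndependent.pair_iff' (by simpa using hli.ne_zero 0)]
      exact fun p hp => (LinearIndependent.pair_iff' (hli.ne_zero 0)).mp hli p
        (congrArg WithLp.ofLp hp)
    rw [← Matrix.range_cons_cons_empty, finrank_span_eq_card hlin, Fintype.card_fin]
  isotropic u hu v hv := by
    have hann : ∀ u ∈ Submodule.span ℂ {(toLp 2 x : C7), toLp 2 c}, imMul x u.ofLp = 0 := by
      intro u hu
      obtain ⟨a, b, rfl⟩ := Submodule.mem_span_pair.mp hu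
      simp [imMul_add, imMul_smul, hxc]
    exact dotProduct_eq_zero_of_mem_annihilator (hli.ne_zero 0) hxx (hann u hu) (hann v hv)
  imMul_eq_zero u hu v hv := by
    obtain ⟨a, b, rfl⟩ := Submodule.mem_span_pair.mp hu
    obtain ⟨a', b', rfl⟩ := Submodule.mem_span_pair.mp hv
    simp [imMul_add, add_imMul, imMul_smul, smul_imMul, hxc, imMul_eq_zero_comm.mp hxc]

/-! ### Leading coefficients at a pole -/

section LinearAlgebra

variable {K : Type*} [Field K]

theorem exists_mulVec_ne_zero {m n R : Type*} [Fintype n] [NonAssocSemiring R] {A : Matrix m n R}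
    (hA : A ≠ 0) : ∃ u, A *ᵥ u ≠ 0 := by
  contrapose! hA
  exact Matrix.ext_iff_mulVec.mpr fun u => by rw [hA, Matrix.zero_mulVec]

theorem exists_mulVec_eq_smul_of_mem_span_singleton {m n : Type*} [Fintype n]
    {A : Matrix m n K} {x : m → K} (hx : x ≠ 0) (hA : ∀ u, A *ᵥ u ∈ Submodule.span K {x}) :
    ∃ y : n → K, ∀ u, A *ᵥ u = (y ⬝ᵥ u) • x := by
  obtain ⟨i, hi⟩ := Function.ne_iff.mp hx
  refine ⟨(x i)⁻¹ • A i, fun u => ?_⟩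
  obtain ⟨c, hc⟩ := Submodule.mem_span_singleton.mp (hA u)
  have hcoeff : c * x i = A i ⬝ᵥ u := congrFun hc i
  rw [← hc, smul_dotProduct, ← hcoeff, smul_eq_mul, mul_comm c, inv_mul_cancel_left₀ hi]

theorem span_pair_eq_of_linearIndependent {V : Type*} [AddCommGroup V] [Module K V]
    {x y z w : V} (hli : LinearIndependent K ![x, y]) (hx : x ∈ Submodule.span K {z, w})
    (hy : y ∈ Submodule.span K {z, w}) :
    Submodule.span K {x, y} = Submodule.span K {z, w} := by
  classical
  have := FiniteDimensional.span_of_finite K (Set.toFinite {z, w})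
  refine Submodule.eq_of_le_of_finrank_le (Submodule.span_le.mpr (Set.pair_subset hx hy)) ?_
  rw [← Matrix.range_cons_cons_empty x y ![], finrank_span_eq_card hli, Fintype.card_fin]
  refine (finrank_span_le_card {z, w}).trans ?_
  rw [Set.toFinset_insert, Set.toFinset_singleton]
  exact Finset.card_le_two

end LinearAlgebra

theorem exists_linearIndependent_orthogonal {m n : Type*} [Fintype m] [Fintype n]
    {A : Matrix m n ℂ} {e f : n → ℂ}
    (hli : LinearIndependent ℂ ![A *ᵥ e, A *ᵥ f]) :
    ∃ g, LinearIndependent ℂ ![A *ᵥ e, A *ᵥ g] ∧ star (A *ᵥ e) ⬝ᵥ (A *ᵥ g) = 0 := by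
  have he : A *ᵥ e ≠ 0 := hli.ne_zero 0
  set r := (star (A *ᵥ e) ⬝ᵥ (A *ᵥ f)) / (star (A *ᵥ e) ⬝ᵥ (A *ᵥ e)) with hr
  refine ⟨f - r • e, ?_, ?_⟩ <;> rw [Matrix.mulVec_sub, Matrix.mulVec_smul]
  · rw [LinearIndependent.pair_iff' he] at hli ⊢
    intro p hp
    exact hli (p + r) (by rw [add_smul, hp, sub_add_cancel])
  · rw [dotProduct_sub, dotProduct_smul, smul_eq_mul, hr,
      div_mul_cancel₀ _ (star_dotProduct_self_ne_zero he), sub_self]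

theorem exists_linearIndependent_annihilator {x : Fin 7 → ℂ} (hx : x ≠ 0) (hxx : x ⬝ᵥ x = 0)
    (y : Fin 7 → ℂ) : ∃ c, LinearIndependent ℂ ![x, c] ∧ imMul x c = 0 ∧ star x ⬝ᵥ c = 0 ∧
      y ⬝ᵥ c = 0 := by
  obtain ⟨c, hc0, hxc, hsc, hyc⟩ := exists_mem_annihilator hx hxx
    (dotProductBilin ℂ ℂ (star x)) (dotProductBilin ℂ ℂ y)
  refine ⟨c, (LinearIndependent.pair_iff' hx).mpr ?_, hxc, hsc, hyc⟩
  rintro p rfl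
  have hp : p = 0 := by simpa [star_dotProduct_self_ne_zero hx] using hsc
  exact hc0 (by rw [hp, zero_smul])

theorem projMatrix_conjSubspace_span_pair_mulVec {x c : Fin 7 → ℂ} (hx : x ≠ 0) (hc : c ≠ 0)
    (hxc : star x ⬝ᵥ c = 0) (v : Fin 7 → ℂ) :
    projMatrix (conjSubspace (Submodule.span ℂ {(toLp 2 x : C7), toLp 2 c})) *ᵥ v =
      ((x ⬝ᵥ v) / (star x ⬝ᵥ x)) • star x + ((c ⬝ᵥ v) / (star c ⬝ᵥ c)) • star c := by
  have hcx : star c ⬝ᵥ x = 0 := by rw [Matrix.star_dotProduct, hxc, star_zero]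
  refine projMatrix_mulVec_eq ?_ fun w hw => ?_
  · rw [toLp_mem_conjSubspace, toLp_mem_span_pair, Submodule.mem_span_pair]
    exact ⟨_, _, by rw [star_add, star_smul, star_smul, star_star, star_star]⟩
  · obtain ⟨a, b, hab⟩ := Submodule.mem_span_pair.mp (toLp_mem_span_pair.mp hw)
    simp only [← hab, dotProduct_sub, dotProduct_add, add_dotProduct, dotProduct_smul,
      smul_dotProduct, dotProduct_comm x (star _), dotProduct_comm c (star _), hxc, hcx,
      smul_eq_mul]
    field_simp [star_dotProduct_self_ne_zero hx, star_dotProduct_self_ne_zero hc]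
    ring

/-- The relations between the value `A` and the derivative `D` at a pole of the numerator of a loop
in `G₂`, where `q` is the derivative of the denominator. -/
structure IsPolePair (A D : Matrix (Fin 7) (Fin 7) ℂ) (q : ℂ) : Prop where
  imMul_eq : ∀ u v, imMul (A *ᵥ u) (A *ᵥ v) = 0
  dot_eq : ∀ u v, (A *ᵥ u) ⬝ᵥ (A *ᵥ v) = 0
  dot_deriv : ∀ u v, (D *ᵥ u) ⬝ᵥ (A *ᵥ v) + (A *ᵥ u) ⬝ᵥ (D *ᵥ v) = 0
  imMul_deriv : ∀ u v, imMul (D *ᵥ u) (A *ᵥ v) + imMul (A *ᵥ u) (D *ᵥ v) = q • A *ᵥ imMul u v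

/-- A plane `W` such that multiplication by the simple element of `W` lowers the order of a pole
with leading coefficients `A`, `D`. -/
structure IsReducing (W : Submodule ℂ C7) (A D : Matrix (Fin 7) (Fin 7) ℂ) : Prop where
  isComplexCoassociative : IsComplexCoassociative W
  mulVec_mem : ∀ u, toLp 2 (A *ᵥ u) ∈ W
  dotProduct_eq_zero : ∀ w, toLp 2 w ∈ W → ∀ u, w ⬝ᵥ (D *ᵥ u) = 0

/-- The value at a pole `α` of the product of the simple element of `W` and a numerator with value
`A` and derivative `D` at `α`, where `s = α - conj α`. -/
noncomputable def rotatedLeading (W : Submodule ℂ C7) (s : ℂ) (A D : Matrix (Fin 7) (Fin 7) ℂ) :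
    Matrix (Fin 7) (Fin 7) ℂ :=
  s • (projMatrix (conjSubspace W) * D) + projMatrix (assocComplement W) * A

theorem rotatedLeading_mulVec (W : Submodule ℂ C7) (s : ℂ) (A D : Matrix (Fin 7) (Fin 7) ℂ)
    (u : Fin 7 → ℂ) : rotatedLeading W s A D *ᵥ u =
      s • projMatrix (conjSubspace W) *ᵥ (D *ᵥ u)
        + projMatrix (assocComplement W) *ᵥ (A *ᵥ u) := by
  simp only [rotatedLeading, Matrix.add_mulVec, Matrix.smul_mulVec, Matrix.mulVec_mulVec]

section
variable {A D : Matrix (Fin 7) (Fin 7) ℂ} {q : ℂ}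

theorem IsReducing.rotatedLeading_eq_zero {W : Submodule ℂ C7} (h : IsReducing W A D) (s : ℂ) :
    rotatedLeading W s A D = 0 :=
  Matrix.ext_iff_mulVec.mpr fun u => by
    rw [rotatedLeading_mulVec, projMatrix_assocComplement_mulVec_of_mem (h.mulVec_mem u),
      projMatrix_conjSubspace_mulVec_eq_zero fun w hw => h.dotProduct_eq_zero w hw u, smul_zero,
      add_zero, Matrix.zero_mulVec]

namespace IsPolePair

theorem dot_self (h : IsPolePair A D q) (u : Fin 7 → ℂ) : (A *ᵥ u) ⬝ᵥ (D *ᵥ u) = 0 := by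
  have hu := h.dot_deriv u u
  rw [dotProduct_comm, ← two_mul] at hu
  simpa using hu

theorem dotProduct_deriv_eq (h : IsPolePair A D q) {e f u : Fin 7 → ℂ} {a b : ℂ}
    (hu : a • A *ᵥ e + b • A *ᵥ f = A *ᵥ u) :
    (A *ᵥ e) ⬝ᵥ (D *ᵥ u) = -(b * ((D *ᵥ e) ⬝ᵥ (A *ᵥ f))) := by
  have heu := h.dot_deriv e u
  rw [← hu, dotProduct_add, dotProduct_smul, dotProduct_smul, dotProduct_comm (D *ᵥ e),
    h.dot_self e, smul_zero, zero_add] at heu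
  exact eq_neg_of_add_eq_zero_right heu

theorem mem_span_pair (h : IsPolePair A D q) {e f : Fin 7 → ℂ}
    (hli : LinearIndependent ℂ ![A *ᵥ e, A *ᵥ f]) (u : Fin 7 → ℂ) :
    A *ᵥ u ∈ Submodule.span ℂ {A *ᵥ e, A *ᵥ f} :=
  mem_span_pair_of_imMul_eq_zero (h.dot_eq e e) hli (h.imMul_eq e f) (h.imMul_eq e u)
    (h.imMul_eq f u)

theorem eq_zero_of_mulVec_eq_smul (h : IsPolePair A D q) {x n : Fin 7 → ℂ} (hx : x ≠ 0)
    (hn : n ≠ 0) (hA : ∀ u, A *ᵥ u = (n ⬝ᵥ u) • x) : q = 0 := by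
  obtain ⟨y, z, hy, hz, hyz⟩ := exists_dotProduct_imMul_ne_zero hn
  simpa [hA, hy, hz, hx, hyz] using (h.imMul_deriv y z).symm

theorem exists_isReducing_of_rank_one (h : IsPolePair A D q) {e : Fin 7 → ℂ} (he : A *ᵥ e ≠ 0)
    (hr : ∀ u, A *ᵥ u ∈ Submodule.span ℂ {A *ᵥ e}) : ∃ W, IsReducing W A D := by
  obtain ⟨n, hA⟩ := exists_mulVec_eq_smul_of_mem_span_singleton he hr
  have hxx := h.dot_eq e e
  have hxe := h.dot_self e
  have hne : n ⬝ᵥ e = 1 := smul_left_injective ℂ he (by simpa using (hA e).symm)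
  have hq : q = 0 := h.eq_zero_of_mulVec_eq_smul he (by rintro rfl; simp at hne) hA
  have hD : ∀ z, n ⬝ᵥ z = 0 → imMul (A *ᵥ e) (D *ᵥ z) = 0 := fun z hz => by
    simpa [hA z, hz, hq] using h.imMul_deriv e z
  obtain ⟨c, hli, hxc, -, hec⟩ := exists_linearIndependent_annihilator he hxx (D *ᵥ e)
  have hW := isComplexCoassociative_span_pair hxx hxc hli
  have hxW := Submodule.mem_span_of_mem (R := ℂ)
    (Set.mem_insert (toLp 2 (A *ᵥ e)) {(toLp 2 c : C7)})
  refine ⟨_, hW, fun u => ?_, fun w hw u => ?_⟩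
  · rw [hA u]
    exact Submodule.smul_mem _ _ hxW
  · have hker : w ⬝ᵥ (D *ᵥ (u - (n ⬝ᵥ u) • e)) = 0 :=
      dotProduct_eq_zero_of_mem_annihilator he hxx (hW.imMul_mem_mem hxW hw)
        (hD _ (by simp [hne]))
    have hwe : w ⬝ᵥ (D *ᵥ e) = 0 := by
      obtain ⟨a, b, rfl⟩ := Submodule.mem_span_pair.mp (toLp_mem_span_pair.mp hw)
      rw [add_dotProduct, smul_dotProduct, smul_dotProduct, hxe, dotProduct_comm c, hec,
        smul_zero, smul_zero, add_zero]
    simpa [Matrix.mulVec_sub, Matrix.mulVec_smul, hwe] using hker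

theorem exists_isReducing_of_rank_two (h : IsPolePair A D q) {e f : Fin 7 → ℂ}
    (hli : LinearIndependent ℂ ![A *ᵥ e, A *ᵥ f]) (he : ∀ u, (A *ᵥ e) ⬝ᵥ (D *ᵥ u) = 0) :
    ∃ W, IsReducing W A D := by
  refine ⟨_, isComplexCoassociative_span_pair (h.dot_eq e e) (h.imMul_eq e f) hli,
    fun u => toLp_mem_span_pair.mpr (h.mem_span_pair hli u), fun w hw u => ?_⟩
  obtain ⟨a, b, rfl⟩ := Submodule.mem_span_pair.mp (toLp_mem_span_pair.mp hw)
  obtain ⟨a', b', hu⟩ := Submodule.mem_span_pair.mp (h.mem_span_pair hli u)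
  have hf : (A *ᵥ f) ⬝ᵥ (D *ᵥ u) = 0 := by
    have hfu := h.dot_deriv f u
    rw [← hu, dotProduct_add, dotProduct_smul, dotProduct_smul,
      dotProduct_comm (D *ᵥ f) (A *ᵥ e), he f, dotProduct_comm (D *ᵥ f) (A *ᵥ f),
      h.dot_self f] at hfu
    simpa using hfu
  rw [add_dotProduct, smul_dotProduct, smul_dotProduct, he, hf, smul_zero, smul_zero, add_zero]

theorem exists_isReducing_or_exists_linearIndependent (h : IsPolePair A D q) {e : Fin 7 → ℂ}
    (he : A *ᵥ e ≠ 0) :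
    (∃ W, IsReducing W A D) ∨ ∃ f, LinearIndependent ℂ ![A *ᵥ e, A *ᵥ f] := by
  by_cases hr : ∀ u, A *ᵥ u ∈ Submodule.span ℂ {A *ᵥ e}
  · exact Or.inl (h.exists_isReducing_of_rank_one he hr)
  · push Not at hr
    obtain ⟨f, hf⟩ := hr
    exact Or.inr ⟨f, (LinearIndependent.pair_iff' he).mpr fun p hp =>
      hf (Submodule.mem_span_singleton.mpr ⟨p, hp⟩)⟩

theorem exists_isReducing_of_mem_span (h : IsPolePair A D q) (hA : A ≠ 0) {y z : Fin 7 → ℂ}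
    (hy : y ≠ 0) (hyD : ∀ u, y ⬝ᵥ (D *ᵥ u) = 0)
    (hspan : ∀ u, A *ᵥ u ∈ Submodule.span ℂ {z, y}) : ∃ W, IsReducing W A D := by
  obtain ⟨e, he⟩ := exists_mulVec_ne_zero hA
  obtain hW | ⟨f, hli⟩ := h.exists_isReducing_or_exists_linearIndependent he
  · exact hW
  have hyA : y ∈ Submodule.span ℂ {A *ᵥ e, A *ᵥ f} :=
    (span_pair_eq_of_linearIndependent hli (hspan e) (hspan f)).ge
      (Submodule.mem_span_of_mem (Set.mem_insert_of_mem _ rfl))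
  obtain ⟨a, b, hab⟩ := Submodule.mem_span_pair.mp hyA
  obtain ⟨u, rfl⟩ : ∃ u, A *ᵥ u = y :=
    ⟨a • e + b • f, by rw [Matrix.mulVec_add, Matrix.mulVec_smul, Matrix.mulVec_smul, hab]⟩
  obtain hW | ⟨v, huv⟩ := h.exists_isReducing_or_exists_linearIndependent hy
  · exact hW
  · exact h.exists_isReducing_of_rank_two huv hyD

theorem exists_rotatedLeading_mem_span (h : IsPolePair A D q) {e f : Fin 7 → ℂ}
    (hli : LinearIndependent ℂ ![A *ᵥ e, A *ᵥ f]) (horth : star (A *ᵥ e) ⬝ᵥ (A *ᵥ f) = 0) (s : ℂ) :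
    ∃ W, IsComplexCoassociative W ∧ (∀ w, toLp 2 w ∈ W → ∀ u, w ⬝ᵥ (A *ᵥ u) = 0) ∧
      ∃ y z, y ≠ 0 ∧ toLp 2 y ∈ conjSubspace W ∧ (∀ u, y ⬝ᵥ (A *ᵥ u) = 0) ∧
        ∀ u, rotatedLeading W s A D *ᵥ u ∈ Submodule.span ℂ {z, y} := by
  have hx : A *ᵥ e ≠ 0 := hli.ne_zero 0
  have hxx := h.dot_eq e e
  obtain ⟨c, hxc_li, hxc, hxc_orth, hfc⟩ :=
    exists_linearIndependent_annihilator hx hxx (star (A *ᵥ f))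
  have hc : c ≠ 0 := hxc_li.ne_zero 1
  have hcf : star c ⬝ᵥ (A *ᵥ f) = 0 := by rw [Matrix.star_dotProduct, hfc, star_zero]
  have hW := isComplexCoassociative_span_pair hxx hxc hxc_li
  set W := Submodule.span ℂ {(toLp 2 (A *ᵥ e) : C7), toLp 2 c}
  have hxW : toLp 2 (A *ᵥ e) ∈ W := Submodule.mem_span_of_mem (Set.mem_insert _ _)
  have hWA : ∀ w, toLp 2 w ∈ W → ∀ u, w ⬝ᵥ (A *ᵥ u) = 0 := fun w hw u =>
    dotProduct_eq_zero_of_mem_annihilator hx hxx (hW.imMul_mem_mem hxW hw) (h.imMul_eq e u)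
  have hfW : toLp 2 (A *ᵥ f) ∈ assocComplement W := by
    refine toLp_mem_assocComplement.mpr fun w hw => ⟨hWA w hw f, ?_⟩
    obtain ⟨a, b, rfl⟩ := Submodule.mem_span_pair.mp (toLp_mem_span_pair.mp hw)
    rw [star_add, star_smul, star_smul, add_dotProduct, smul_dotProduct, smul_dotProduct, horth,
      hcf, smul_zero, smul_zero, add_zero]
  refine ⟨W, hW, hWA, star c,
    A *ᵥ f - (s * ((D *ᵥ e) ⬝ᵥ (A *ᵥ f)) / (star (A *ᵥ e) ⬝ᵥ (A *ᵥ e))) • star (A *ᵥ e),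
    star_ne_zero.mpr hc, toLp_star_mem_conjSubspace.mpr
      (Submodule.mem_span_of_mem (Set.mem_insert_of_mem _ rfl)), fun u => ?_, fun u => ?_⟩ <;>
  obtain ⟨a, b, hab⟩ := Submodule.mem_span_pair.mp (h.mem_span_pair hli u)
  · rw [← hab, dotProduct_add, dotProduct_smul, dotProduct_smul, hcf, Matrix.star_dotProduct,
      hxc_orth, star_zero, smul_zero, smul_zero, add_zero]
  · refine Submodule.mem_span_pair.mpr ⟨b, s * ((c ⬝ᵥ (D *ᵥ u)) / (star c ⬝ᵥ c)), ?_⟩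
    rw [rotatedLeading_mulVec, projMatrix_conjSubspace_span_pair_mulVec hx hc hxc_orth,
      h.dotProduct_deriv_eq hab, ← hab, Matrix.mulVec_add, Matrix.mulVec_smul, Matrix.mulVec_smul,
      projMatrix_assocComplement_mulVec_of_mem hxW, projMatrix_mulVec_of_mem hfW]
    module

end IsPolePair

theorem IsReducing.dotProduct_mulVec_eq_zero {W : Submodule ℂ C7} (h : IsReducing W A D)
    {w : Fin 7 → ℂ} (hw : toLp 2 w ∈ W) (u : Fin 7 → ℂ) : w ⬝ᵥ (A *ᵥ u) = 0 :=
  h.isComplexCoassociative.dotProduct_mem_mem hw (h.mulVec_mem u)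

end

/-! ### Generic points -/

section DenseOpen

variable {X Y : Type*} [TopologicalSpace X] [TopologicalSpace Y]

theorem denseOpen_le_codiscrete [T1Space X] [∀ x : X, NeBot (𝓝[≠] x)] :
    denseOpen X ≤ codiscrete X := by
  intro s hs
  refine ⟨interior s, isOpen_interior, fun x => ?_, interior_subset⟩
  have hx : s ∈ 𝓝[≠] x := by
    simpa only [disjoint_principal_right, compl_compl] using mem_codiscrete.mp hs x
  have h_interior : ∀ᶠ y in 𝓝[≠] x, y ∈ interior s := by
    filter_upwards [eventually_eventually_nhdsWithin.mpr hx, self_mem_nhdsWithin] with y hy hyx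
    rw [isOpen_compl_singleton.nhdsWithin_eq hyx] at hy
    exact mem_interior_iff_mem_nhds.mpr hy
  exact mem_closure_iff_frequently.mpr (h_interior.frequently.filter_mono nhdsWithin_le_nhds)

theorem denseOpen_le_cofinite [T1Space X] [∀ x : X, NeBot (𝓝[≠] x)] : denseOpen X ≤ cofinite :=
  denseOpen_le_codiscrete.trans codiscrete_le_cofinite

theorem tendsto_denseOpen {f : X → Y} (hf : Continuous f) (hfo : IsOpenMap f) :
    Tendsto f (denseOpen X) (denseOpen Y) := fun _ ⟨U, hU, hUd, hUs⟩ =>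
  ⟨f ⁻¹' U, hU.preimage hf, hUd.preimage hfo, Set.preimage_mono hUs⟩

theorem map_denseOpen {f : X → Y} (hf : Continuous f) (hfo : IsOpenMap f) (hfd : DenseRange f) :
    map f (denseOpen X) = denseOpen Y :=
  le_antisymm (tendsto_denseOpen hf hfo) fun _ ⟨U, hU, hUd, hUs⟩ =>
    ⟨f '' U, hfo U hU, hfd.dense_image hf hUd, Set.image_subset_iff.mpr hUs⟩

theorem eq_of_eventuallyEq_denseOpen [T2Space Y] {f g : X → Y} (hf : Continuous f)
    (hg : Continuous g) (h : f =ᶠ[denseOpen X] g) : f = g :=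
  let ⟨_, _, hUd, hU⟩ := h
  hf.ext_on hUd hg hU

theorem frequently_cocompact_of_eventually_denseOpen [T2Space X] [NoncompactSpace X]
    {P : X → Prop} (h : ∀ᶠ x in denseOpen X, P x) : ∃ᶠ x in cocompact X, P x := by
  obtain ⟨U, -, hUd, hU⟩ := h
  intro hP
  obtain ⟨K, hK, hKP⟩ := mem_cocompact.mp hP
  obtain ⟨x, hxK, hxU⟩ := hUd.inter_open_nonempty _ hK.isClosed.isOpen_compl
    (Set.nonempty_compl.mpr hK.ne_univ)
  exact hKP hxK (hU hxU)

theorem eventually_denseOpen_onePoint [NoncompactSpace X] {P : OnePoint X → Prop} :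
    (∀ᶠ p in denseOpen (OnePoint X), P p) ↔ ∀ᶠ x : X in denseOpen X, P x := by
  rw [← map_denseOpen OnePoint.continuous_coe OnePoint.isOpenEmbedding_coe.isOpenMap
    OnePoint.denseRange_coe, eventually_map]

theorem tendsto_conj_denseOpen : Tendsto conj (denseOpen ℂ) (denseOpen ℂ) :=
  tendsto_denseOpen Complex.continuous_conj Complex.conjLIE.toHomeomorph.isOpenMap

end DenseOpen

/-! ### Numerators of loops -/

/-- The common denominator `∏ (z - a) (z - conj a)` of a real rational loop whose poles are among
the entries `a` of `l` and their conjugates, counted with multiplicity. -/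
noncomputable def conjPoleProd (l : List ℂ) (z : ℂ) : ℂ :=
  (l.map fun a => (z - a) * (z - conj a)).prod

theorem conjPoleProd_nil (z : ℂ) : conjPoleProd [] z = 1 := rfl

theorem conjPoleProd_cons (a : ℂ) (l : List ℂ) (z : ℂ) :
    conjPoleProd (a :: l) z = (z - a) * (z - conj a) * conjPoleProd l z := by
  rw [conjPoleProd, List.map_cons, List.prod_cons, conjPoleProd]

theorem differentiable_conjPoleProd (l : List ℂ) : Differentiable ℂ (conjPoleProd l) := by
  induction l with
  | nil => exact differentiable_const 1
  | cons a l ih =>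
    rw [funext (conjPoleProd_cons a l)]
    fun_prop

theorem conjPoleProd_conj (l : List ℂ) (z : ℂ) :
    conjPoleProd l (conj z) = conj (conjPoleProd l z) := by
  induction l with
  | nil => simp only [conjPoleProd_nil, map_one]
  | cons a l ih =>
    simp only [conjPoleProd_cons, map_mul, map_sub, Complex.conj_conj, ih]
    ring

theorem eventually_conjPoleProd_ne_zero (l : List ℂ) :
    ∀ᶠ z in cofinite, conjPoleProd l z ≠ 0 := by
  induction l with
  | nil => exact Eventually.of_forall fun _ => one_ne_zero
  | cons a l ih =>
    filter_upwards [ih, eventually_cofinite_ne a, eventually_cofinite_ne (conj a)] with z hl ha ha'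
    rw [conjPoleProd_cons]
    exact mul_ne_zero (mul_ne_zero (sub_ne_zero.mpr ha) (sub_ne_zero.mpr ha')) hl

/-- A matrix-valued function on `ℂ` with entire entries.  (Matrices carry no global norm, so
differentiability is expressed entrywise.) -/
def IsEntire {m n : Type*} (H : ℂ → Matrix m n ℂ) : Prop :=
  ∀ i j, Differentiable ℂ fun z => H z i j

theorem IsEntire.continuous {m n : Type*} {H : ℂ → Matrix m n ℂ} (h : IsEntire H) :
    Continuous H :=
  continuous_matrix fun i j => (h i j).continuous

/-- The loop with numerator `H` and denominator `conjPoleProd l`; its value at a zero of the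
denominator is `0`. -/
noncomputable def loopValue {m n : Type*} (l : List ℂ) (H : ℂ → Matrix m n ℂ) (z : ℂ) :
    Matrix m n ℂ :=
  (conjPoleProd l z)⁻¹ • H z

theorem smul_loopValue {m n : Type*} {l : List ℂ} {z : ℂ} (hz : conjPoleProd l z ≠ 0)
    (H : ℂ → Matrix m n ℂ) : conjPoleProd l z • loopValue l H z = H z :=
  smul_inv_smul₀ hz _

theorem loopValue_eq_iff {m n : Type*} {l : List ℂ} {H : ℂ → Matrix m n ℂ} {z : ℂ}
    {A : Matrix m n ℂ} (hz : conjPoleProd l z ≠ 0) :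
    loopValue l H z = A ↔ H z = conjPoleProd l z • A :=
  inv_smul_eq_iff₀ hz

/-- `H` is the numerator of a real rational loop in `G₂` with denominator `conjPoleProd l` and with
value `1` at `∞`.  The equations for the values of the loop are stated without denominators, so that
they make sense at the poles. -/
structure IsLoopNumerator (l : List ℂ) (H : ℂ → Matrix (Fin 7) (Fin 7) ℂ) : Prop where
  isEntire : IsEntire H
  dot_eq : ∀ z u v, (H z *ᵥ u) ⬝ᵥ (H z *ᵥ v) = conjPoleProd l z ^ 2 * (u ⬝ᵥ v)
  imMul_eq : ∀ z u v, imMul (H z *ᵥ u) (H z *ᵥ v) = conjPoleProd l z • H z *ᵥ imMul u v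
  map_conj : ∀ z, (H (conj z)).map conj = H z
  tendsto : Tendsto (loopValue l H) (cocompact ℂ) (𝓝 1)

theorem continuous_imMul {X : Type*} [TopologicalSpace X] {f g : X → Fin 7 → ℂ}
    (hf : Continuous f) (hg : Continuous g) : Continuous fun x => imMul (f x) (g x) :=
  (imMulBilin.toContinuousBilinearMap.continuous.comp hf).clm_apply hg

namespace IsLoopNumerator

variable {l : List ℂ} {H : ℂ → Matrix (Fin 7) (Fin 7) ℂ} {z : ℂ}

theorem of_eventually_denseOpen (hH : IsEntire H)
    (hG : ∀ᶠ z in denseOpen ℂ, IsG2Matrix (loopValue l H z))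
    (hconj : ∀ᶠ z in denseOpen ℂ, (loopValue l H (conj z)).map conj = loopValue l H z)
    (hlim : Tendsto (loopValue l H) (cocompact ℂ) (𝓝 1)) : IsLoopNumerator l H := by
  have hQ := (differentiable_conjPoleProd l).continuous
  have hQ0 := denseOpen_le_cofinite (eventually_conjPoleProd_ne_zero l)
  have hHu (u) : Continuous fun z => H z *ᵥ u := hH.continuous.matrix_mulVec continuous_const
  have hdot (u v) : (fun z => (H z *ᵥ u) ⬝ᵥ (H z *ᵥ v)) =
      fun z => conjPoleProd l z ^ 2 * (u ⬝ᵥ v) := by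
    refine eq_of_eventuallyEq_denseOpen (by fun_prop) (by fun_prop) ?_
    filter_upwards [hG, hQ0] with z hz hz0
    simp only [← smul_loopValue hz0 H, Matrix.smul_mulVec, smul_dotProduct, dotProduct_smul,
      hz.dotProduct_eq, smul_eq_mul]
    ring
  have himMul (u v) : (fun z => imMul (H z *ᵥ u) (H z *ᵥ v)) =
      fun z => conjPoleProd l z • H z *ᵥ imMul u v := by
    refine eq_of_eventuallyEq_denseOpen (continuous_imMul (hHu u) (hHu v)) (by fun_prop) ?_
    filter_upwards [hG, hQ0] with z hz hz0
    simp only [← smul_loopValue hz0 H, Matrix.smul_mulVec, imMul_smul, smul_imMul,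
      hz.mulVec_imMul]
  have hmap : (fun z => (H (conj z)).map conj) = H := by
    have hHconj := hH.continuous.comp Complex.continuous_conj
    refine eq_of_eventuallyEq_denseOpen (hHconj.matrix_map Complex.continuous_conj) hH.continuous ?_
    filter_upwards [hconj, hQ0] with z hz hz0
    have hz0' : conjPoleProd l (conj z) ≠ 0 := by rwa [conjPoleProd_conj, map_ne_zero]
    rw [← smul_loopValue hz0 H, ← hz, ← smul_loopValue hz0' H, map_conj_smul, conjPoleProd_conj,
      Complex.conj_conj]
  exact ⟨hH, fun z u v => congrFun (hdot u v) z, fun z u v => congrFun (himMul u v) z,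
    congrFun hmap, hlim⟩

theorem isG2Matrix_loopValue (h : IsLoopNumerator l H) (hz : conjPoleProd l z ≠ 0) :
    IsG2Matrix (loopValue l H z) where
  dotProduct_eq u v := by
    simp only [loopValue, Matrix.smul_mulVec, smul_dotProduct, dotProduct_smul, h.dot_eq,
      smul_eq_mul]
    field_simp
  mulVec_imMul u v := by
    simp only [loopValue, Matrix.smul_mulVec, smul_imMul, imMul_smul, h.imMul_eq,
      inv_smul_smul₀ hz]

theorem loopValue_conj (h : IsLoopNumerator l H) (z : ℂ) :
    (loopValue l H (conj z)).map conj = loopValue l H z := by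
  rw [loopValue, map_conj_smul, h.map_conj, conjPoleProd_conj, ← map_inv₀, Complex.conj_conj,
    loopValue]

end IsLoopNumerator

/-! ### Germs of loops -/

section Germs

variable {n : ℕ} {F G : ℂ → Matrix (Fin n) (Fin n) ℂ}

open Classical in
/-- An invertible matrix as an element of `GL`; the value at a singular matrix is `1`. -/
noncomputable def matrixToGL (A : Matrix (Fin n) (Fin n) ℂ) : GL (Fin n) ℂ :=
  if h : IsUnit A then h.unit else 1

theorem coe_matrixToGL {A : Matrix (Fin n) (Fin n) ℂ} (h : IsUnit A) :
    (matrixToGL A : Matrix (Fin n) (Fin n) ℂ) = A := by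
  rw [matrixToGL, dif_pos h, IsUnit.unit_spec]

theorem matrixToGL_coe (A : GL (Fin n) ℂ) : matrixToGL (A : Matrix (Fin n) (Fin n) ℂ) = A :=
  Units.ext (coe_matrixToGL A.isUnit)

/-- The germ of the loop with matrices `F z` at the finite points `z`.  It is meaningful when these
are invertible on a dense open set; the value at the remaining points is `1`. -/
noncomputable def matrixGerm (F : ℂ → Matrix (Fin n) (Fin n) ℂ) : LoopGerm n :=
  ((fun p => p.elim 1 fun z => matrixToGL (F z) : OnePoint ℂ → GL (Fin n) ℂ) : LoopGerm n)

theorem matrixGerm_eq_coe {f : OnePoint ℂ → GL (Fin n) ℂ}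
    (h : ∀ᶠ z : ℂ in denseOpen ℂ, F z = f z) : matrixGerm F = ↑f := by
  rw [matrixGerm, Germ.coe_eq, EventuallyEq, eventually_denseOpen_onePoint]
  filter_upwards [h] with z hz
  rw [OnePoint.elim_some, hz, matrixToGL_coe]

theorem matrixGerm_congr (h : F =ᶠ[denseOpen ℂ] G) : matrixGerm F = matrixGerm G := by
  rw [matrixGerm, matrixGerm, Germ.coe_eq, EventuallyEq, eventually_denseOpen_onePoint]
  filter_upwards [h] with z hz
  rw [OnePoint.elim_some, OnePoint.elim_some, hz]

theorem matrixGerm_mul (hF : ∀ᶠ z in denseOpen ℂ, IsUnit (F z))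
    (hG : ∀ᶠ z in denseOpen ℂ, IsUnit (G z)) :
    matrixGerm (fun z => F z * G z) = matrixGerm F * matrixGerm G := by
  refine matrixGerm_eq_coe ?_
  filter_upwards [hF, hG] with z hFz hGz
  simp only [OnePoint.elim_some, Units.val_mul, coe_matrixToGL hFz, coe_matrixToGL hGz]

end Germs

/-! ### Multiplication by simple elements -/

/-- The value of the simple element `p_{α,W}` at a finite point. -/
noncomputable def simpleValue (α : ℂ) (W : Submodule ℂ C7) (z : ℂ) : Matrix (Fin 7) (Fin 7) ℂ :=
  simpleMatrix W ((z - α) / (z - conj α))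

theorem eventually_div_sub_conj_ne_zero (α : ℂ) :
    ∀ᶠ z in cofinite, (z - α) / (z - conj α) ≠ 0 := by
  filter_upwards [eventually_cofinite_ne α, eventually_cofinite_ne (conj α)] with z hz hz'
  exact div_ne_zero (sub_ne_zero.mpr hz) (sub_ne_zero.mpr hz')

theorem simpleValue_map_conj (α : ℂ) (W : Submodule ℂ C7) (z : ℂ) :
    (simpleValue α W (conj z)).map conj = simpleValue α W z := by
  rw [simpleValue, simpleMatrix_map_conj, simpleValue]
  simp only [map_div₀, map_sub, Complex.conj_conj, inv_div]

theorem continuousAt_simpleMatrix (W : Submodule ℂ C7) {r : ℂ} (hr : r ≠ 0) :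
    ContinuousAt (simpleMatrix W) r :=
  (((continuousAt_inv₀ hr).smul continuousAt_const).add continuousAt_const).add
    (continuousAt_id.smul continuousAt_const)

theorem tendsto_sub_div_sub_cocompact (a b : ℂ) :
    Tendsto (fun z => (z - a) / (z - b)) (cocompact ℂ) (𝓝 1) := by
  have hinv : Tendsto (fun z : ℂ => (z - b)⁻¹) (cocompact ℂ) (𝓝 0) := by
    rw [← Metric.cobounded_eq_cocompact]
    exact tendsto_inv₀_cobounded.comp (tendsto_sub_const_cobounded b)
  have hlim := (hinv.const_mul (b - a)).const_add 1
  rw [mul_zero, add_zero] at hlim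
  refine hlim.congr' ?_
  filter_upwards [cocompact_le_cofinite (eventually_cofinite_ne b)] with z hz
  have hzb := sub_ne_zero.mpr hz
  field_simp
  ring

namespace IsComplexCoassociative

variable {W : Submodule ℂ C7} (hW : IsComplexCoassociative W)
include hW

theorem simpleMatrix_one : simpleMatrix W 1 = 1 := by
  rw [simpleMatrix, inv_one, one_smul, one_smul, hW.projMatrix_add]

theorem eventually_isG2Matrix_simpleValue (α : ℂ) :
    ∀ᶠ z in cofinite, IsG2Matrix (simpleValue α W z) :=
  (eventually_div_sub_conj_ne_zero α).mono fun _ hz => hW.isG2Matrix_simpleMatrix hz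

theorem tendsto_simpleValue (α : ℂ) : Tendsto (simpleValue α W) (cocompact ℂ) (𝓝 1) := by
  have h := (continuousAt_simpleMatrix W one_ne_zero).tendsto.comp
    (tendsto_sub_div_sub_cocompact α (conj α))
  rwa [hW.simpleMatrix_one] at h

theorem matrixGerm_simpleValue (α : ℂ) : matrixGerm (simpleValue α W) = simpleElement α W hW := by
  refine matrixGerm_eq_coe ?_
  filter_upwards [denseOpen_le_cofinite (eventually_div_sub_conj_ne_zero α)] with z hz
  rw [dif_pos (show blaschke α z ≠ 0 from hz)]
  rfl

end IsComplexCoassociative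

namespace IsLoopNumerator

variable {l l' : List ℂ} {H H' : ℂ → Matrix (Fin 7) (Fin 7) ℂ} {α : ℂ} {W : Submodule ℂ C7}

theorem simple_mul (h : IsLoopNumerator l H) (hW : IsComplexCoassociative W) (hH' : IsEntire H')
    (hval : loopValue l' H' =ᶠ[cofinite] fun z => simpleValue α W z * loopValue l H z) :
    IsLoopNumerator l' H' := by
  have hval' := denseOpen_le_cofinite hval
  refine .of_eventually_denseOpen hH' ?_ ?_ ?_
  · filter_upwards [hval', denseOpen_le_cofinite (hW.eventually_isG2Matrix_simpleValue α),
      denseOpen_le_cofinite (eventually_conjPoleProd_ne_zero l)] with z hz hzα hzl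
    rw [hz]
    exact hzα.mul (h.isG2Matrix_loopValue hzl)
  · filter_upwards [hval', tendsto_conj_denseOpen.eventually hval'] with z hz hz'
    rw [hz, hz', Matrix.map_mul, simpleValue_map_conj, h.loopValue_conj]
  · have hlim := (hW.tendsto_simpleValue α).mul h.tendsto
    rw [one_mul] at hlim
    exact hlim.congr' (EventuallyEq.symm (cocompact_le_cofinite hval))

theorem matrixGerm_simple_mul (h : IsLoopNumerator l H) (hW : IsComplexCoassociative W)
    (hval : loopValue l' H' =ᶠ[cofinite] fun z => simpleValue α W z * loopValue l H z) :
    matrixGerm (loopValue l' H') = simpleElement α W hW * matrixGerm (loopValue l H) := by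
  rw [matrixGerm_congr (denseOpen_le_cofinite hval), matrixGerm_mul, hW.matrixGerm_simpleValue]
  · exact denseOpen_le_cofinite
      ((hW.eventually_isG2Matrix_simpleValue α).mono fun _ hz => hz.isUnit)
  · exact denseOpen_le_cofinite
      ((eventually_conjPoleProd_ne_zero l).mono fun _ hz => (h.isG2Matrix_loopValue hz).isUnit)

end IsLoopNumerator

/-! ### Entire matrix functions -/

/-- The entrywise derivative of a matrix-valued function. -/
noncomputable def matrixDeriv {m n : Type*} (H : ℂ → Matrix m n ℂ) (a : ℂ) : Matrix m n ℂ :=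
  Matrix.of fun i j => deriv (fun z => H z i j) a

theorem hasDerivAt_dotProduct {n : Type*} [Fintype n] {f g : ℂ → n → ℂ} {f' g' : n → ℂ} {a : ℂ}
    (hf : HasDerivAt f f' a) (hg : HasDerivAt g g' a) :
    HasDerivAt (fun z => f z ⬝ᵥ g z) (f' ⬝ᵥ g a + f a ⬝ᵥ g') a := by
  rw [add_comm]
  exact (dotProductBilin ℂ ℂ).toContinuousBilinearMap.hasDerivAt_of_bilinear
    (fun _ => hf) fun _ => hg

theorem hasDerivAt_imMul {f g : ℂ → Fin 7 → ℂ} {f' g' : Fin 7 → ℂ} {a : ℂ}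
    (hf : HasDerivAt f f' a) (hg : HasDerivAt g g' a) :
    HasDerivAt (fun z => imMul (f z) (g z)) (imMul f' (g a) + imMul (f a) g') a := by
  rw [add_comm]
  exact imMulBilin.toContinuousBilinearMap.hasDerivAt_of_bilinear (fun _ => hf) fun _ => hg

theorem eq_of_sub_pow_smul_eq {E : Type*} [AddCommGroup E] [Module ℂ E] [TopologicalSpace E]
    [T2Space E] {F G : ℂ → E} {a : ℂ} (k : ℕ) (hF : Continuous F) (hG : Continuous G)
    (h : ∀ z, (z - a) ^ k • F z = (z - a) ^ k • G z) : F = G := by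
  refine eq_of_eventuallyEq_denseOpen hF hG (denseOpen_le_cofinite ?_)
  filter_upwards [eventually_cofinite_ne a] with z hz
  exact smul_right_injective E (pow_ne_zero k (sub_ne_zero.mpr hz)) (h z)

namespace IsEntire

section
variable {m n : Type*} {H K : ℂ → Matrix m n ℂ}

theorem add (hH : IsEntire H) (hK : IsEntire K) : IsEntire fun z => H z + K z :=
  fun i j => (hH i j).add (hK i j)

theorem sub_smul (hH : IsEntire H) (a : ℂ) : IsEntire fun z => (z - a) • H z :=
  fun i j => (differentiable_id.sub_const a).mul (hH i j)

theorem map_conj (hH : IsEntire H) : IsEntire fun z => (H (conj z)).map conj := fun i j z => by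
  have h := (hH i j (conj z)).conj_conj
  rwa [Complex.conj_conj] at h

theorem exists_eq_sub_smul (hH : IsEntire H) {a : ℂ} (ha : H a = 0) :
    ∃ K, IsEntire K ∧ (∀ z, H z = (z - a) • K z) ∧ K a = matrixDeriv H a := by
  refine ⟨fun z => Matrix.of fun i j => dslope (fun z => H z i j) a z, fun i j => ?_, fun z => ?_,
    ?_⟩
  · exact differentiableOn_univ.mp
      ((Complex.differentiableOn_dslope univ_mem).mpr (hH i j).differentiableOn)
  · ext i j
    have h := sub_smul_dslope (fun z => H z i j) a z
    rw [ha, Matrix.zero_apply, sub_zero] at h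
    exact h.symm
  · ext i j
    exact dslope_same _ _

end

section
variable {k m n : Type*} [Fintype m] {H : ℂ → Matrix m n ℂ}

theorem mul_left (hH : IsEntire H) (P : Matrix k m ℂ) : IsEntire fun z => P * H z := fun i j => by
  simp only [Matrix.mul_apply]
  exact Differentiable.fun_sum fun p _ => (hH p j).const_mul (P i p)

theorem matrixDeriv_mul_left (hH : IsEntire H) (P : Matrix k m ℂ) (a : ℂ) :
    matrixDeriv (fun z => P * H z) a = P * matrixDeriv H a := by
  ext i j
  simp only [matrixDeriv, Matrix.of_apply, Matrix.mul_apply]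
  rw [deriv_fun_sum fun p _ => (hH p j a).const_mul (P i p)]
  exact Finset.sum_congr rfl fun p _ => deriv_const_mul (P i p) (hH p j a)

end

section
variable {m n : Type*} [Fintype n] {H : ℂ → Matrix m n ℂ}

theorem hasDerivAt_mulVec [Finite m] (hH : IsEntire H) (a : ℂ) (u : n → ℂ) :
    HasDerivAt (fun z => H z *ᵥ u) (matrixDeriv H a *ᵥ u) a := by
  cases nonempty_fintype m
  exact hasDerivAt_pi.mpr fun i =>
    HasDerivAt.fun_sum fun j _ => (hH i j a).hasDerivAt.mul_const (u j)

variable [Fintype m]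

theorem hasDerivAt_dotProduct_mulVec (hH : IsEntire H) (a : ℂ) (y : m → ℂ) (u : n → ℂ) :
    HasDerivAt (fun z => y ⬝ᵥ (H z *ᵥ u)) (y ⬝ᵥ (matrixDeriv H a *ᵥ u)) a := by
  have h := hasDerivAt_dotProduct (hasDerivAt_const a y) (hH.hasDerivAt_mulVec a u)
  rwa [zero_dotProduct, zero_add] at h

theorem dotProduct_matrixDeriv_eq_zero {H' : ℂ → Matrix m n ℂ} (hH : IsEntire H)
    (hH' : IsEntire H') {a b : ℂ} (hab : a ≠ b) {y : m → ℂ} {u : n → ℂ}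
    (h : ∀ z, (z - b) * (y ⬝ᵥ (H' z *ᵥ u)) = (z - a) * (y ⬝ᵥ (H z *ᵥ u)))
    (ha : y ⬝ᵥ (H a *ᵥ u) = 0) : y ⬝ᵥ (matrixDeriv H' a *ᵥ u) = 0 := by
  have hba := sub_ne_zero.mpr hab
  have hval : y ⬝ᵥ (H' a *ᵥ u) = 0 := by
    have h_at := h a
    rw [sub_self, zero_mul] at h_at
    exact (mul_eq_zero.mp h_at).resolve_left hba
  have hleft := ((hasDerivAt_id' a).sub_const b).fun_mul (hH'.hasDerivAt_dotProduct_mulVec a y u)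
  have hright := ((hasDerivAt_id' a).sub_const a).fun_mul (hH.hasDerivAt_dotProduct_mulVec a y u)
  rw [← funext h] at hright
  have hderiv := hleft.unique hright
  rw [ha, hval, sub_self, mul_zero, zero_mul, zero_add, zero_add] at hderiv
  exact (mul_eq_zero.mp hderiv).resolve_left hba

end

end IsEntire

theorem IsLoopNumerator.isPolePair {l : List ℂ} {H : ℂ → Matrix (Fin 7) (Fin 7) ℂ}
    (h : IsLoopNumerator l H) {a : ℂ} (ha : conjPoleProd l a = 0) :
    IsPolePair (H a) (matrixDeriv H a) (deriv (conjPoleProd l) a) := by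
  have hH := h.isEntire.hasDerivAt_mulVec a
  have hQ := (differentiable_conjPoleProd l a).hasDerivAt
  refine ⟨fun u v => ?_, fun u v => ?_, fun u v => ?_, fun u v => ?_⟩
  · rw [h.imMul_eq, ha, zero_smul]
  · rw [h.dot_eq, ha, zero_pow two_ne_zero, zero_mul]
  · have hdot := hasDerivAt_dotProduct (hH u) (hH v)
    simp only [h.dot_eq] at hdot
    rw [hdot.unique ((hQ.fun_pow 2).mul_const (u ⬝ᵥ v)), ha]
    simp
  · have himMul := hasDerivAt_imMul (hH u) (hH v)
    simp only [h.imMul_eq] at himMul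
    rw [himMul.unique (hQ.fun_smul (hH (imMul u v))), ha, zero_smul, zero_add]

/-! ### Lowering the order of a pole -/

theorem sub_conj_ne_zero {α : ℂ} (hα : α.im ≠ 0) : α - conj α ≠ 0 :=
  sub_ne_zero.mpr fun h => hα (Complex.conj_eq_iff_im.mp h.symm)

theorem eq_zero_of_map_conj_of_dotProduct {m n : Type*} [Fintype m] [Fintype n]
    {A : Matrix m n ℂ} (hA : A.map conj = A) (hdot : ∀ u v, (A *ᵥ u) ⬝ᵥ (A *ᵥ v) = 0) : A = 0 := by
  classical
  refine Matrix.ext_iff_mulVec.mpr fun u => ?_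
  rw [Matrix.zero_mulVec]
  by_contra hu
  refine star_dotProduct_self_ne_zero hu ?_
  rw [← star_star u, ← map_conj_mulVec, hA, star_star, hdot]

theorem simpleValue_mul (α : ℂ) (W : Submodule ℂ C7) (z : ℂ) (A : Matrix (Fin 7) (Fin 7) ℂ) :
    simpleValue α W z * A = ((z - conj α) / (z - α)) • (projMatrix (conjSubspace W) * A)
      + projMatrix (assocComplement W) * A
      + ((z - α) / (z - conj α)) • (projMatrix W * A) := by
  rw [simpleValue, simpleMatrix, add_mul, add_mul, smul_mul_assoc, smul_mul_assoc, inv_div]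

theorem IsComplexCoassociative.dotProduct_simpleMatrix_mulVec {W : Submodule ℂ C7}
    (hW : IsComplexCoassociative W) {r : ℂ} (hr : r ≠ 0) {y : Fin 7 → ℂ}
    (hy : toLp 2 y ∈ conjSubspace W) (v : Fin 7 → ℂ) :
    y ⬝ᵥ (simpleMatrix W r *ᵥ v) = r * (y ⬝ᵥ v) := by
  rw [← hW.simpleMatrix_dotProduct hr y v, hW.simpleMatrix_mulVec_of_mem_conj r hy, smul_dotProduct,
    smul_eq_mul, mul_inv_cancel_left₀ hr]

namespace IsLoopNumerator

variable {l : List ℂ} {H : ℂ → Matrix (Fin 7) (Fin 7) ℂ} {α : ℂ}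

theorem exists_of_factor (h : IsLoopNumerator (α :: l) H) {K : ℂ → Matrix (Fin 7) (Fin 7) ℂ}
    (hK : IsEntire K) (hHK : ∀ z, H z = ((z - α) * (z - conj α)) • K z) :
    ∃ H', IsLoopNumerator l H' ∧
      matrixGerm (loopValue l H') = matrixGerm (loopValue (α :: l) H) := by
  have hval : loopValue l K =ᶠ[cofinite] loopValue (α :: l) H := by
    filter_upwards [eventually_conjPoleProd_ne_zero (α :: l)] with z hz
    rw [conjPoleProd_cons] at hz
    rw [loopValue, loopValue, hHK, smul_smul, conjPoleProd_cons, mul_inv_rev, mul_assoc,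
      inv_mul_cancel₀ (left_ne_zero_of_mul hz), mul_one]
  have hval' := denseOpen_le_cofinite hval
  refine ⟨K, .of_eventually_denseOpen hK ?_ ?_ ?_, matrixGerm_congr hval'⟩
  · filter_upwards [hval', denseOpen_le_cofinite (eventually_conjPoleProd_ne_zero (α :: l))]
      with z hz hz0
    rw [hz]
    exact h.isG2Matrix_loopValue hz0
  · filter_upwards [hval', tendsto_conj_denseOpen.eventually hval'] with z hz hz'
    rw [hz, hz', h.loopValue_conj]
  · exact h.tendsto.congr' (EventuallyEq.symm (cocompact_le_cofinite hval))

theorem exists_of_eq_zero (h : IsLoopNumerator (α :: l) H) (hα : α.im ≠ 0) (hA : H α = 0) :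
    ∃ H', IsLoopNumerator l H' ∧
      matrixGerm (loopValue l H') = matrixGerm (loopValue (α :: l) H) := by
  obtain ⟨K, hK, hHK, -⟩ := h.isEntire.exists_eq_sub_smul hA
  have hHconj : H (conj α) = 0 := by
    rw [← h.map_conj, Complex.conj_conj, hA, Matrix.map_zero _ (map_zero conj)]
  have hKconj : K (conj α) = 0 := by
    rw [hHK, smul_eq_zero, sub_eq_zero] at hHconj
    exact hHconj.resolve_left fun h_eq => sub_conj_ne_zero hα (sub_eq_zero.mpr h_eq.symm)
  obtain ⟨K', hK', hKK', -⟩ := hK.exists_eq_sub_smul hKconj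
  exact h.exists_of_factor hK' fun z => by rw [hHK, hKK', smul_smul]

/-- At a real point, both the value of the numerator and its quotient by `z - α` are real and
isotropic. -/
theorem exists_of_im_eq_zero (h : IsLoopNumerator (α :: l) H) (hα : α.im = 0) :
    ∃ H', IsLoopNumerator l H' ∧
      matrixGerm (loopValue l H') = matrixGerm (loopValue (α :: l) H) := by
  have hconj : conj α = α := Complex.conj_eq_iff_im.mpr hα
  have hQ (z) : conjPoleProd (α :: l) z = (z - α) * ((z - α) * conjPoleProd l z) := by
    rw [conjPoleProd_cons, hconj, mul_assoc]
  have hA : H α = 0 := by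
    refine eq_zero_of_map_conj_of_dotProduct ?_ fun u v => ?_
    · simpa only [hconj] using h.map_conj α
    · rw [h.dot_eq, hQ, sub_self, zero_mul, zero_pow two_ne_zero, zero_mul]
  obtain ⟨K, hK, hHK, -⟩ := h.isEntire.exists_eq_sub_smul hA
  have hKreal : (fun z => (K (conj z)).map conj) = K := by
    refine eq_of_sub_pow_smul_eq (a := α) 1 hK.map_conj.continuous hK.continuous fun z => ?_
    rw [pow_one, ← hHK, ← h.map_conj, hHK, map_conj_smul, map_sub, Complex.conj_conj, hconj]
  have hKdot (u v) : (fun z => (K z *ᵥ u) ⬝ᵥ (K z *ᵥ v)) =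
      fun z => ((z - α) * conjPoleProd l z) ^ 2 * (u ⬝ᵥ v) := by
    have hKu (u) : Continuous fun z => K z *ᵥ u := hK.continuous.matrix_mulVec continuous_const
    have hQc := (differentiable_conjPoleProd l).continuous
    refine eq_of_sub_pow_smul_eq (a := α) 2 (by fun_prop) (by fun_prop) fun z => ?_
    have hdot := h.dot_eq z u v
    rw [hHK, hQ, Matrix.smul_mulVec, Matrix.smul_mulVec, smul_dotProduct, dotProduct_smul] at hdot
    rw [pow_two, mul_smul, hdot, smul_eq_mul]
    ring
  have hK0 : K α = 0 := by
    refine eq_zero_of_map_conj_of_dotProduct ?_ fun u v => ?_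
    · simpa only [hconj] using congrFun hKreal α
    · rw [congrFun (hKdot u v) α, sub_self, zero_mul, zero_pow two_ne_zero, zero_mul]
  obtain ⟨K', hK', hKK', -⟩ := hK.exists_eq_sub_smul hK0
  exact h.exists_of_factor hK' fun z => by rw [hHK, hKK', smul_smul, hconj]

theorem projMatrix_mul (h : IsLoopNumerator l H) (U : Submodule ℂ C7) (z : ℂ) :
    projMatrix U * H z = (projMatrix (conjSubspace U) * H (conj z)).map conj := by
  rw [Matrix.map_mul, h.map_conj, projMatrix_map_conj, conjSubspace_conjSubspace]

theorem exists_isEntire_simpleValue_mul (h : IsLoopNumerator l H) {W : Submodule ℂ C7}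
    (hA : ∀ w, toLp 2 w ∈ W → ∀ u, w ⬝ᵥ (H α *ᵥ u) = 0) :
    ∃ H', IsEntire H' ∧ (H' =ᶠ[cofinite] fun z => simpleValue α W z * H z) ∧
      H' α = rotatedLeading W (α - conj α) (H α) (matrixDeriv H α) := by
  have hzero : projMatrix (conjSubspace W) * H α = 0 := Matrix.ext_iff_mulVec.mpr fun u => by
    rw [← Matrix.mulVec_mulVec, Matrix.zero_mulVec,
      projMatrix_conjSubspace_mulVec_eq_zero fun w hw => hA w hw u]
  obtain ⟨K, hK, hHK, hKα⟩ :=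
    (h.isEntire.mul_left (projMatrix (conjSubspace W))).exists_eq_sub_smul hzero
  rw [h.isEntire.matrixDeriv_mul_left] at hKα
  have hHKconj (z) : projMatrix W * H z = (z - conj α) • (K (conj z)).map conj := by
    rw [h.projMatrix_mul, hHK, map_conj_smul, map_sub, Complex.conj_conj]
  refine ⟨fun z => (z - conj α) • K z + projMatrix (assocComplement W) * H z
    + (z - α) • (K (conj z)).map conj,
    ((hK.sub_smul _).add (h.isEntire.mul_left _)).add (hK.map_conj.sub_smul _), ?_, ?_⟩
  · filter_upwards [eventually_cofinite_ne α, eventually_cofinite_ne (conj α)] with z hz hz'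
    rw [simpleValue_mul, hHK, hHKconj, smul_smul, smul_smul,
      div_mul_cancel₀ _ (sub_ne_zero.mpr hz), div_mul_cancel₀ _ (sub_ne_zero.mpr hz')]
  · beta_reduce
    rw [hKα, sub_self, zero_smul, add_zero, rotatedLeading]

theorem exists_simple_mul (h : IsLoopNumerator l H) (hα : α.im ≠ 0) {W : Submodule ℂ C7}
    (hW : IsComplexCoassociative W) (hA : ∀ w, toLp 2 w ∈ W → ∀ u, w ⬝ᵥ (H α *ᵥ u) = 0) :
    ∃ H', IsLoopNumerator l H' ∧
      matrixGerm (loopValue l H') = simpleElement α W hW * matrixGerm (loopValue l H) ∧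
      H' α = rotatedLeading W (α - conj α) (H α) (matrixDeriv H α) ∧
      ∀ y, toLp 2 y ∈ conjSubspace W → (∀ u, y ⬝ᵥ (H α *ᵥ u) = 0) →
        ∀ u, y ⬝ᵥ (matrixDeriv H' α *ᵥ u) = 0 := by
  obtain ⟨H', hH', hval, hH'α⟩ := h.exists_isEntire_simpleValue_mul hA
  have hloop : loopValue l H' =ᶠ[cofinite] fun z => simpleValue α W z * loopValue l H z :=
    hval.mono fun z hz => by simp only [loopValue, hz, Matrix.mul_smul]
  refine ⟨H', h.simple_mul hW hH' hloop, h.matrixGerm_simple_mul hW hloop, hH'α,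
    fun y hy hyA u => ?_⟩
  have hcont {G : ℂ → Matrix (Fin 7) (Fin 7) ℂ} (hG : IsEntire G) :
      Continuous fun z => G z *ᵥ u := hG.continuous.matrix_mulVec continuous_const
  have heq : (fun z => (z - conj α) * (y ⬝ᵥ (H' z *ᵥ u))) =
      fun z => (z - α) * (y ⬝ᵥ (H z *ᵥ u)) := by
    refine eq_of_eventuallyEq_denseOpen
      ((continuous_id.sub continuous_const).mul (continuous_const.dotProduct (hcont hH')))
      ((continuous_id.sub continuous_const).mul (continuous_const.dotProduct (hcont h.isEntire)))
      (denseOpen_le_cofinite ?_)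
    filter_upwards [hval, eventually_div_sub_conj_ne_zero α, eventually_cofinite_ne (conj α)]
      with z hz hz0 hz'
    rw [hz, ← Matrix.mulVec_mulVec, simpleValue, hW.dotProduct_simpleMatrix_mulVec hz0 hy,
      ← mul_assoc, mul_div_cancel₀ _ (sub_ne_zero.mpr hz')]
  exact h.isEntire.dotProduct_matrixDeriv_eq_zero hH' (sub_ne_zero.mp (sub_conj_ne_zero hα))
    (congrFun heq) (hyA u)

end IsLoopNumerator

/-- The simple elements `p_{α,W}` of the theorem. -/
def simpleElements : Set (LoopGerm 7) :=
  {γ | ∃ (α : ℂ) (W : Submodule ℂ C7) (hW : IsComplexCoassociative W), α.im ≠ 0 ∧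
    γ = simpleElement α W hW}

theorem simpleElement_mem_closure {α : ℂ} (hα : α.im ≠ 0) {W : Submodule ℂ C7}
    (hW : IsComplexCoassociative W) : simpleElement α W hW ∈ Subgroup.closure simpleElements :=
  Subgroup.subset_closure ⟨α, W, hW, hα, rfl⟩

namespace IsLoopNumerator

variable {l : List ℂ} {H : ℂ → Matrix (Fin 7) (Fin 7) ℂ} {α : ℂ}

theorem exists_of_isReducing (h : IsLoopNumerator (α :: l) H) (hα : α.im ≠ 0) {W : Submodule ℂ C7}
    (hW : IsReducing W (H α) (matrixDeriv H α)) :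
    ∃ H', IsLoopNumerator l H' ∧ ∃ γ ∈ Subgroup.closure simpleElements,
      matrixGerm (loopValue l H') = γ * matrixGerm (loopValue (α :: l) H) := by
  obtain ⟨H₁, hH₁, hgerm₁, hval, -⟩ := h.exists_simple_mul hα hW.isComplexCoassociative
    fun _ hw => hW.dotProduct_mulVec_eq_zero hw
  rw [hW.rotatedLeading_eq_zero] at hval
  obtain ⟨H₂, hH₂, hgerm₂⟩ := hH₁.exists_of_eq_zero hα hval
  exact ⟨H₂, hH₂, _, simpleElement_mem_closure hα hW.isComplexCoassociative, hgerm₂.trans hgerm₁⟩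

theorem exists_of_eq_zero_or_isReducing (h : IsLoopNumerator (α :: l) H) (hα : α.im ≠ 0)
    (hH : H α = 0 ∨ ∃ W, IsReducing W (H α) (matrixDeriv H α)) :
    ∃ H', IsLoopNumerator l H' ∧ ∃ γ ∈ Subgroup.closure simpleElements,
      matrixGerm (loopValue l H') = γ * matrixGerm (loopValue (α :: l) H) := by
  obtain hA | ⟨W, hW⟩ := hH
  · obtain ⟨H', hH', hgerm⟩ := h.exists_of_eq_zero hα hA
    exact ⟨H', hH', 1, one_mem _, by rw [hgerm, one_mul]⟩
  · exact h.exists_of_isReducing hα hW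

theorem exists_lower (h : IsLoopNumerator (α :: l) H) :
    ∃ H', IsLoopNumerator l H' ∧ ∃ γ ∈ Subgroup.closure simpleElements,
      matrixGerm (loopValue l H') = γ * matrixGerm (loopValue (α :: l) H) := by
  by_cases hα : α.im = 0
  · obtain ⟨H', hH', hgerm⟩ := h.exists_of_im_eq_zero hα
    exact ⟨H', hH', 1, one_mem _, by rw [hgerm, one_mul]⟩
  have hQ : conjPoleProd (α :: l) α = 0 := by rw [conjPoleProd_cons, sub_self, zero_mul, zero_mul]
  by_cases hA : H α = 0
  · exact h.exists_of_eq_zero_or_isReducing hα (Or.inl hA)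
  obtain ⟨e, he⟩ := exists_mulVec_ne_zero hA
  obtain hW | ⟨f, hf⟩ := (h.isPolePair hQ).exists_isReducing_or_exists_linearIndependent he
  · exact h.exists_of_eq_zero_or_isReducing hα (Or.inr hW)
  obtain ⟨g, hg, horth⟩ := exists_linearIndependent_orthogonal hf
  obtain ⟨W, hW, hWA, y, z, hy, hyW, hyA, hspan⟩ :=
    (h.isPolePair hQ).exists_rotatedLeading_mem_span hg horth (α - conj α)
  obtain ⟨H₁, hH₁, hgerm₁, hval, hderiv⟩ := h.exists_simple_mul hα hW hWA
  rw [← hval] at hspan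
  obtain ⟨H₂, hH₂, γ, hγ, hgerm₂⟩ := hH₁.exists_of_eq_zero_or_isReducing hα <|
    or_iff_not_imp_left.mpr fun hA₁ =>
      (hH₁.isPolePair hQ).exists_isReducing_of_mem_span hA₁ hy (hderiv y hyW hyA) hspan
  exact ⟨H₂, hH₂, γ * simpleElement α W hW, mul_mem hγ (simpleElement_mem_closure hα hW),
    by rw [hgerm₂, hgerm₁, mul_assoc]⟩

theorem loopValue_nil (h : IsLoopNumerator [] H) : loopValue [] H = fun _ => 1 := by
  have hloop : loopValue [] H = H := funext fun z => by
    rw [loopValue, conjPoleProd_nil, inv_one, one_smul]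
  have hlim := h.tendsto
  rw [hloop] at hlim
  rw [hloop]
  ext z i j
  exact (h.isEntire i j).apply_eq_of_tendsto_cocompact z
    (((continuous_apply_apply i j).tendsto _).comp hlim)

theorem matrixGerm_mem_closure (h : IsLoopNumerator l H) :
    matrixGerm (loopValue l H) ∈ Subgroup.closure simpleElements := by
  induction l generalizing H with
  | nil =>
    have hone : matrixGerm (loopValue [] H) = 1 :=
      matrixGerm_eq_coe (f := 1) (.of_forall fun z => by rw [h.loopValue_nil]; rfl)
    rw [hone]
    exact one_mem _
  | cons α l ih =>
    obtain ⟨H', hH', γ, hγ, hgerm⟩ := h.exists_lower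
    rw [← Subgroup.mul_mem_cancel_left _ hγ, ← hgerm]
    exact ih hH'

end IsLoopNumerator

/-! ### Simple elements belong to the loop group -/

section SimpleElements

theorem analyticAt_simpleMatrix (W : Submodule ℂ C7) {r : ℂ → ℂ} {a : ℂ} (hr : AnalyticAt ℂ r a)
    (ha : r a ≠ 0) (i j : Fin 7) : AnalyticAt ℂ (fun w => simpleMatrix W (r w) i j) a :=
  (((hr.inv ha).mul analyticAt_const).add analyticAt_const).add (hr.mul analyticAt_const)

theorem meromorphicAt_simpleMatrix (W : Submodule ℂ C7) {r : ℂ → ℂ} {a : ℂ}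
    (hr : MeromorphicAt r a) (i j : Fin 7) :
    MeromorphicAt (fun w => simpleMatrix W (r w) i j) a :=
  ((hr.inv.mul (.const _ _)).add (.const _ _)).add (hr.mul (.const _ _))

theorem blaschke_cpCoord_infty (α w : ℂ) :
    blaschke α (cpCoord ∞ w) = (1 - α * w) / (1 - conj α * w) := by
  by_cases hw : w = 0
  · simp [cpCoord, hw, blaschke]
  · simp only [cpCoord, if_neg hw, blaschke]
    rw [← mul_div_mul_right _ _ hw, sub_mul, sub_mul, inv_mul_cancel₀ hw]

variable {α : ℂ} {W : Submodule ℂ C7}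

open Classical in
/-- The simple element `p_{α,W}` as a map on all of `ℂP¹`, with the value `1` at its poles. -/
noncomputable def simpleMap (α : ℂ) (hW : IsComplexCoassociative W) (p : OnePoint ℂ) :
    GL (Fin 7) ℂ :=
  if h : blaschke α p ≠ 0 then simpleGL W hW (blaschke α p) h else 1

variable (hW : IsComplexCoassociative W)

theorem coe_simpleMap {p : OnePoint ℂ} (hp : blaschke α p ≠ 0) :
    (simpleMap α hW p : Matrix (Fin 7) (Fin 7) ℂ) = simpleMatrix W (blaschke α p) := by
  rw [simpleMap, dif_pos hp, simpleGL]

theorem coe_simpleMap_coe {z : ℂ} (hz : (z - α) / (z - conj α) ≠ 0) :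
    (simpleMap α hW z : Matrix (Fin 7) (Fin 7) ℂ) = simpleValue α W z :=
  coe_simpleMap hW (p := z) hz

theorem simpleMap_infty : simpleMap α hW ∞ = 1 :=
  Units.ext <| (coe_simpleMap hW (p := ∞) one_ne_zero).trans hW.simpleMatrix_one

theorem simpleMap_mem_complexG2 {p : OnePoint ℂ} (hp : blaschke α p ≠ 0) :
    simpleMap α hW p ∈ complexG2 :=
  mem_complexG2_iff.mpr (coe_simpleMap hW hp ▸ hW.isG2Matrix_simpleMatrix hp)

theorem holomorphicAtPt_simpleMap_infty (α : ℂ) :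
    HolomorphicAtPt (fun q => (simpleMap α hW q : Matrix (Fin 7) (Fin 7) ℂ)) ∞ := by
  intro i j
  have hr : AnalyticAt ℂ (fun w : ℂ => (1 - α * w) / (1 - conj α * w)) 0 :=
    AnalyticAt.div (by fun_prop) (by fun_prop) (by simp)
  refine (analyticAt_simpleMatrix W hr (by simp) i j).congr ?_
  filter_upwards [hr.continuousAt.eventually_ne (y := 0) (by simp)] with w hw
  rw [← blaschke_cpCoord_infty] at hw ⊢
  rw [coe_simpleMap hW hw]

theorem holomorphicAtPt_simpleMap_coe {z : ℂ} (hz : (z - α) / (z - conj α) ≠ 0) :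
    HolomorphicAtPt (fun q => (simpleMap α hW q : Matrix (Fin 7) (Fin 7) ℂ)) z := by
  intro i j
  have hr : AnalyticAt ℂ (fun w : ℂ => (w - α) / (w - conj α)) z :=
    AnalyticAt.div (by fun_prop) (by fun_prop) (div_ne_zero_iff.mp hz).2
  refine (analyticAt_simpleMatrix W hr hz i j).congr ?_
  filter_upwards [hr.continuousAt.eventually_ne hz] with w hw
  exact congrFun₂ (coe_simpleMap_coe hW hw).symm i j

theorem meromorphicAtPt_simpleMap (α : ℂ) (p : OnePoint ℂ) :
    MeromorphicAtPt (fun q => (simpleMap α hW q : Matrix (Fin 7) (Fin 7) ℂ)) p := by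
  intro i j
  induction p using OnePoint.rec with
  | infty => exact (holomorphicAtPt_simpleMap_infty hW α i j).meromorphicAt
  | coe z =>
    have hr : MeromorphicAt (fun w : ℂ => (w - α) / (w - conj α)) z := by fun_prop
    refine (meromorphicAt_simpleMatrix W hr i j).congr ?_
    filter_upwards [nhdsNE_le_cofinite z (eventually_div_sub_conj_ne_zero α)] with w hw
    exact congrFun₂ (coe_simpleMap_coe hW hw).symm i j

theorem simpleElement_mem_holomorphicLoops (α : ℂ) :
    simpleElement α W hW ∈ holomorphicLoops complexG2 := by
  obtain ⟨U, hU, hUd, hUα⟩ := eventually_denseOpen_onePoint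
    (P := fun p => simpleMap α hW p ∈ complexG2 ∧
      HolomorphicAtPt (fun q => (simpleMap α hW q : Matrix (Fin 7) (Fin 7) ℂ)) p) |>.mpr <|
    denseOpen_le_cofinite <| (eventually_div_sub_conj_ne_zero α).mono fun z hz =>
      ⟨simpleMap_mem_complexG2 hW (p := z) hz, holomorphicAtPt_simpleMap_coe hW hz⟩
  exact ⟨simpleMap α hW, rfl, U, hU, hUd, hUα⟩

theorem simpleElement_mem_realLoops (α : ℂ) : simpleElement α W hW ∈ realLoops 7 := by
  refine ⟨simpleMap α hW, rfl, eventually_denseOpen_onePoint.mpr ?_⟩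
  have hα := denseOpen_le_cofinite (eventually_div_sub_conj_ne_zero α)
  filter_upwards [hα, tendsto_conj_denseOpen.eventually hα] with z hz hz'
  refine Units.ext ?_
  change (simpleMap α hW (conj z : ℂ) : Matrix (Fin 7) (Fin 7) ℂ).map conj = _
  rw [coe_simpleMap_coe hW hz, coe_simpleMap_coe hW hz', simpleValue_map_conj]

theorem simpleElement_mem (α : ℂ) : simpleElement α W hW ∈ negRationalRealLoops complexG2 :=
  ⟨⟨⟨simpleElement_mem_holomorphicLoops hW α, _, rfl, meromorphicAtPt_simpleMap hW α⟩,
    simpleMap α hW, rfl, holomorphicAtPt_simpleMap_infty hW α, simpleMap_infty hW⟩,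
    simpleElement_mem_realLoops hW α⟩

end SimpleElements

/-! ### Rational loops have numerators -/

theorem conjPoleProd_append (l l' : List ℂ) (z : ℂ) :
    conjPoleProd (l ++ l') z = conjPoleProd l z * conjPoleProd l' z := by
  simp [conjPoleProd]

theorem conjPoleProd_replicate (n : ℕ) (a z : ℂ) :
    conjPoleProd (List.replicate n a) z = ((z - a) * (z - conj a)) ^ n := by
  simp [conjPoleProd]

theorem analyticAt_conjPoleProd (l : List ℂ) (z : ℂ) : AnalyticAt ℂ (conjPoleProd l) z :=
  (differentiable_conjPoleProd l).analyticAt z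

section Meromorphic

variable {E : Type*} [NormedAddCommGroup E] [NormedSpace ℂ E]

theorem meromorphicAt_pi {𝕜 ι : Type*} [NontriviallyNormedField 𝕜] [Fintype ι] {F : ι → Type*}
    [∀ i, NormedAddCommGroup (F i)] [∀ i, NormedSpace 𝕜 (F i)] {f : 𝕜 → ∀ i, F i} {x : 𝕜}
    (h : ∀ i, MeromorphicAt (fun z => f z i) x) : MeromorphicAt f x := by
  choose n hn using h
  refine ⟨∑ i, n i, analyticAt_pi_iff.mpr fun i => ?_⟩
  have hle : n i ≤ ∑ i, n i := Finset.single_le_sum (fun _ _ => Nat.zero_le _) (Finset.mem_univ i)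
  have hpow : AnalyticAt 𝕜 (fun z => (z - x) ^ (∑ i, n i - n i)) x := by fun_prop
  refine (hpow.smul (hn i)).congr (.of_forall fun z => ?_)
  simp only [Pi.smul_apply', smul_smul, pow_sub_mul_pow _ hle, Pi.smul_apply]

variable {f : ℂ → E}

theorem meromorphicOrderAt_conjPoleProd_append_nonneg (hf : Meromorphic f) {l : List ℂ}
    (l' : List ℂ) {z : ℂ} (h : 0 ≤ meromorphicOrderAt (fun w => conjPoleProd l w • f w) z) :
    0 ≤ meromorphicOrderAt (fun w => conjPoleProd (l' ++ l) w • f w) z := by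
  simp only [conjPoleProd_append, mul_smul]
  have hl' := analyticAt_conjPoleProd l' z
  have hl := (analyticAt_conjPoleProd l z).meromorphicAt.smul (hf z)
  exact (add_nonneg hl'.meromorphicOrderAt_nonneg h).trans_eq
    (meromorphicOrderAt_smul hl'.meromorphicAt hl).symm

theorem exists_eventually_meromorphicOrderAt_nonneg [CompleteSpace E] {x : ℂ}
    (hf : MeromorphicAt f x) :
    ∃ l, ∀ᶠ z in 𝓝 x, 0 ≤ meromorphicOrderAt (fun w => conjPoleProd l w • f w) z := by
  obtain ⟨n, hn⟩ := id hf
  refine ⟨List.replicate n x, ?_⟩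
  rw [← nhdsNE_sup_pure, eventually_sup, eventually_pure]
  constructor
  · filter_upwards [hf.eventually_analyticAt] with z hz
    exact ((analyticAt_conjPoleProd _ z).smul hz).meromorphicOrderAt_nonneg
  · have hconj : AnalyticAt ℂ (fun z => (z - conj x) ^ n) x := by fun_prop
    refine ((hconj.smul hn).congr (.of_forall fun z => ?_)).meromorphicOrderAt_nonneg
    simp only [Pi.smul_apply', smul_smul, conjPoleProd_replicate, mul_pow, mul_comm]

theorem exists_meromorphicOrderAt_nonneg [CompleteSpace E] (hf : Meromorphic f)
    (hinf : ∀ᶠ z in cocompact ℂ, AnalyticAt ℂ f z) :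
    ∃ l, ∀ z, 0 ≤ meromorphicOrderAt (fun w => conjPoleProd l w • f w) z := by
  obtain ⟨K, hK, hKf⟩ := mem_cocompact.mp hinf
  obtain ⟨l, hl⟩ :
      ∃ l, ∀ z ∈ K, 0 ≤ meromorphicOrderAt (fun w => conjPoleProd l w • f w) z := by
    refine hK.induction_on ⟨[], fun z hz => hz.elim⟩ ?_ ?_ fun x _ => ?_
    · rintro s t hst ⟨l, hl⟩
      exact ⟨l, fun z hz => hl z (hst hz)⟩
    · rintro s t ⟨l, hl⟩ ⟨l', hl'⟩
      refine ⟨l ++ l', fun z hz => hz.elim (fun hz => ?_) fun hz => ?_⟩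
      · have happ := meromorphicOrderAt_conjPoleProd_append_nonneg hf l' (hl z hz)
        simpa only [conjPoleProd_append, mul_comm] using happ
      · exact meromorphicOrderAt_conjPoleProd_append_nonneg hf l (hl' z hz)
    · obtain ⟨l, hl⟩ := exists_eventually_meromorphicOrderAt_nonneg (hf x)
      exact ⟨_, nhdsWithin_le_nhds hl, l, fun z hz => hz⟩
  refine ⟨l, fun z => ?_⟩
  by_cases hz : z ∈ K
  · exact hl z hz
  · exact ((analyticAt_conjPoleProd l z).smul (hKf hz)).meromorphicOrderAt_nonneg

theorem exists_differentiable_eventuallyEq_codiscrete [CompleteSpace E] (hf : Meromorphic f)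
    (hf0 : ∀ z, 0 ≤ meromorphicOrderAt f z) :
    ∃ F : ℂ → E, Differentiable ℂ F ∧ F =ᶠ[codiscrete ℂ] f := by
  refine ⟨toMeromorphicNFOn f Set.univ, fun z => ?_,
    (toMeromorphicNFOn_eqOn_codiscrete (meromorphicOn_univ.mpr hf)).symm⟩
  have hNF := meromorphicNFOn_toMeromorphicNFOn f Set.univ (Set.mem_univ z)
  refine (hNF.meromorphicOrderAt_nonneg_iff_analyticAt.mp ?_).differentiableAt
  rw [meromorphicOrderAt_toMeromorphicNFOn (meromorphicOn_univ.mpr hf) (Set.mem_univ z)]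
  exact hf0 z

theorem eq_of_eventuallyEq_codiscrete {X Y : Type*} [TopologicalSpace X] [TopologicalSpace Y]
    [T2Space Y] {F G : X → Y} {x : X} [NeBot (𝓝[≠] x)] (hF : ContinuousAt F x)
    (hG : ContinuousAt G x) (h : F =ᶠ[codiscrete X] G) : F x = G x := by
  have hx : {y | F y = G y} ∈ 𝓝[≠] x := by
    simpa only [disjoint_principal_right, compl_compl] using mem_codiscrete.mp h x
  exact ((hF.eventuallyEq_nhds_iff_eventuallyEq_nhdsNE hG).mp hx).eq_of_nhds

end Meromorphic

theorem cpCoord_infty_inv {z : ℂ} (hz : z ≠ 0) : cpCoord ∞ z⁻¹ = z := by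
  simp [cpCoord, hz]

theorem tendsto_inv_cocompact : Tendsto (fun z : ℂ => z⁻¹) (cocompact ℂ) (𝓝[≠] 0) := by
  rw [← Metric.cobounded_eq_cocompact]
  exact tendsto_inv₀_cobounded'

section AtInfinity

variable {n : ℕ} {M f : OnePoint ℂ → Matrix (Fin n) (Fin n) ℂ}

theorem MeromorphicAtPt.eventually_analyticAt_cocompact (hM : MeromorphicAtPt M ∞) :
    ∀ᶠ z in cocompact ℂ, ∀ i j, AnalyticAt ℂ (fun w : ℂ => M w i j) z := by
  have hchart : ∀ᶠ w in 𝓝[≠] (0 : ℂ), ∀ i j, AnalyticAt ℂ (fun w => M (cpCoord ∞ w) i j) w :=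
    eventually_all.mpr fun i => eventually_all.mpr fun j => (hM i j).eventually_analyticAt
  filter_upwards [tendsto_inv_cocompact.eventually hchart,
    cocompact_le_cofinite (eventually_cofinite_ne 0)] with z hz hz0 i j
  refine ((hz i j).comp_of_eq (analyticAt_inv hz0) rfl).congr ?_
  filter_upwards [eventually_ne_nhds hz0] with w hw
  simp only [Function.comp_apply, cpCoord_infty_inv hw]

theorem MeromorphicAtPt.tendsto_cocompact (hM : MeromorphicAtPt M ∞) (hf : HolomorphicAtPt f ∞)
    (hMf : ∀ᶠ z : ℂ in denseOpen ℂ, M z = f z) :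
    Tendsto (fun z : ℂ => M z) (cocompact ℂ) (𝓝 (f ∞)) := by
  have hne : ∀ᶠ z : ℂ in cocompact ℂ, z ≠ 0 := cocompact_le_cofinite (eventually_cofinite_ne 0)
  refine tendsto_pi_nhds.mpr fun i => tendsto_pi_nhds.mpr fun j => ?_
  have hfreq : ∃ᶠ w in 𝓝[≠] (0 : ℂ), M (cpCoord ∞ w) i j = f (cpCoord ∞ w) i j := by
    refine tendsto_inv_cocompact.frequently ?_
    refine ((frequently_cocompact_of_eventually_denseOpen hMf).and_eventually hne).mono ?_
    rintro z ⟨hz, hz0⟩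
    rw [cpCoord_infty_inv hz0, hz]
  have hMf' := ((hM i j).frequently_eq_iff_eventuallyEq (hf i j).meromorphicAt).mp hfreq
  have hlim : Tendsto (fun w => f (cpCoord ∞ w) i j) (𝓝[≠] 0) (𝓝 (f ∞ i j)) := by
    have hcont := (hf i j).continuousAt.tendsto.mono_left (nhdsWithin_le_nhds (s := {0}ᶜ))
    rwa [show cpCoord ∞ (cpCenter ∞) = ∞ from if_pos rfl] at hcont
  refine ((hlim.congr' hMf'.symm).comp tendsto_inv_cocompact).congr' ?_
  filter_upwards [hne] with z hz0
  simp only [Function.comp_apply, cpCoord_infty_inv hz0]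

end AtInfinity

theorem exists_isEntire_loopValue_eventuallyEq {m n : Type*} [Finite m] [Finite n]
    {N : ℂ → Matrix m n ℂ} (hN : ∀ i j, Meromorphic fun z => N z i j)
    (hinf : ∀ᶠ z in cocompact ℂ, ∀ i j, AnalyticAt ℂ (fun w => N w i j) z) :
    ∃ l H, IsEntire H ∧ loopValue l H =ᶠ[codiscrete ℂ] N ∧ loopValue l H =ᶠ[cocompact ℂ] N := by
  cases nonempty_fintype m
  cases nonempty_fintype n
  let f : ℂ → m → n → ℂ := N
  have hf : Meromorphic f := fun z =>
    meromorphicAt_pi fun i => meromorphicAt_pi fun j => hN i j z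
  have hfinf : ∀ᶠ z in cocompact ℂ, AnalyticAt ℂ f z := by
    filter_upwards [hinf] with z hz
    exact analyticAt_pi_iff.mpr fun i => analyticAt_pi_iff.mpr fun j => hz i j
  obtain ⟨l, hl⟩ := exists_meromorphicOrderAt_nonneg hf hfinf
  obtain ⟨H, hH, hHf⟩ := exists_differentiable_eventuallyEq_codiscrete
    (fun z => (analyticAt_conjPoleProd l z).meromorphicAt.smul (hf z)) hl
  have hQ0 := eventually_conjPoleProd_ne_zero l
  refine ⟨l, H, fun i j => differentiable_pi.mp (differentiable_pi.mp hH i) j, ?_, ?_⟩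
  · filter_upwards [hHf, codiscrete_le_cofinite hQ0] with z hz hz0
    exact (loopValue_eq_iff hz0).mpr hz
  · filter_upwards [hfinf, cocompact_le_cofinite hQ0] with z hz hz0
    exact (loopValue_eq_iff hz0).mpr <| eq_of_eventuallyEq_codiscrete
      hH.continuous.continuousAt ((analyticAt_conjPoleProd l z).smul hz).continuousAt hHf

theorem exists_isLoopNumerator {γ : LoopGerm 7} (hγ : γ ∈ negRationalRealLoops complexG2) :
    ∃ l H, IsLoopNumerator l H ∧ matrixGerm (loopValue l H) = γ := by
  obtain ⟨⟨⟨⟨f, rfl, U, hU, hUd, hf⟩, M, hfM, hM⟩, f₂, hf₂, hhol, hone⟩, f₃, hf₃, hreal⟩ := hγ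
  have hfG : ∀ᶠ z : ℂ in denseOpen ℂ, f z ∈ complexG2 :=
    eventually_denseOpen_onePoint.mp ⟨U, hU, hUd, fun p hp => (hf p hp).1⟩
  have hfM : ∀ᶠ z : ℂ in denseOpen ℂ, f z = M z :=
    eventually_denseOpen_onePoint.mp (Germ.coe_eq.mp hfM)
  have hf₂ : ∀ᶠ z : ℂ in denseOpen ℂ, f z = f₂ z :=
    eventually_denseOpen_onePoint.mp (Germ.coe_eq.mp hf₂)
  have hf₃ : ∀ᶠ z : ℂ in denseOpen ℂ, f z = f₃ z :=
    eventually_denseOpen_onePoint.mp (Germ.coe_eq.mp hf₃)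
  have hMlim := (hM ∞).tendsto_cocompact hhol
    (by filter_upwards [hfM, hf₂] with z hz hz₂; rw [← hz, hz₂])
  rw [hone, Units.val_one] at hMlim
  obtain ⟨l, H, hH, hHM, hHM'⟩ := exists_isEntire_loopValue_eventuallyEq
    (fun i j z => hM z i j) (hM ∞).eventually_analyticAt_cocompact
  have hHf : ∀ᶠ z : ℂ in denseOpen ℂ, loopValue l H z = f z := by
    filter_upwards [denseOpen_le_codiscrete hHM, hfM] with z hz hfz
    rw [hz, hfz]
  refine ⟨l, H, .of_eventually_denseOpen hH ?_ ?_ (hMlim.congr' hHM'.symm), matrixGerm_eq_coe hHf⟩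
  · filter_upwards [hHf, hfG] with z hz hzG
    rw [hz]
    exact mem_complexG2_iff.mp hzG
  · have hconj := tendsto_conj_denseOpen.eventually (hHf.and hf₃)
    filter_upwards [hHf, hf₃, hconj, eventually_denseOpen_onePoint.mp hreal] with z hz hz₃ hz' hzr
    rw [hz, hz'.1, hz'.2, hz₃]
    exact congrArg Units.val hzr

/-- The simple elements `p_{α,W}`, for `α ∈ ℂ ∖ ℝ` and `W` a complex coassociative plane, generate
the negative rational real loop group of the complex group `G₂` on `ℂ⁷`. -/
theorem mainTheorem3 :
    Subgroup.closure {γ : LoopGerm 7 | ∃ (α : ℂ) (W : Submodule ℂ C7)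
        (hW : IsComplexCoassociative W), α.im ≠ 0 ∧ γ = simpleElement α W hW}
      = negRationalRealLoops complexG2 := by
  apply le_antisymm
  · rw [Subgroup.closure_le]
    rintro _ ⟨α, W, hW, -, rfl⟩
    exact simpleElement_mem hW α
  · intro γ hγ
    obtain ⟨l, H, h, rfl⟩ := exists_isLoopNumerator hγ
    exact h.matrixGerm_mem_closure
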